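/- Let $\mathcal X$ be a finite set and let $W_0,W_1$ be irreducible transition matrices on $\mathcal X$ with the same support ($W(x|\bar x)$ is the probability of moving from $\bar x$ to $x$, and $W_0(x|\bar x)=0\iff W_1(x|\bar x)=0$). Let $P_0,P_1$ be probability distributions on $\mathcal X$ with the same support, $n\ge 0$ an integer and $r>0$ a real number. Let $W_i^{\times n}\times P_i$ be the law of the path $(X_1,\dots,X_{n+1})$ of the Markov chain with initial distribution $P_i$ and transition matrix $W_i$. For distributions $Q_0,Q_1$ on a finite set $\Omega$ let $\beta_\epsilon(Q_1\|Q_0)$ be the minimum of $\mathsf E_{Q_0}[1-T]$ over all tests $T:\Omega\to[0,1]$ with $\mathsf E_{Q_1}[T]\le\epsilon$, and let $\beta^{\det}_\epsilon(Q_1\|Q_0)$ be the same minimum over the indicator functions $T=1_S$, $S\subset\Omega$. For $\theta\in\mathbb R$ let $\tilde W_\theta(x|\bar x):=W_0(x|\bar x)\,e^{\theta g(x,\bar x)}$ with $g(x,\bar x):=\log\frac{W_1(x|\bar x)}{W_0(x|\bar x)}$ (and $\tilde W_\theta(x|\bar x):=0$ where $W_0(x|\bar x)=0$), let $\lambda_\theta$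 be its Perron–Frobenius eigenvalue and $\phi(\theta):=\log\lambda_\theta$. Let $v_\theta>0$ be the Perron–Frobenius eigenvector of the transpose $\tilde W_\theta^T$, normalized by $\min_x v_\theta(x)=1$; let $w_\theta(x):=P_0(x)\bigl(P_1(x)/P_0(x)\bigr)^{\theta}$ (and $0$ where $P_0(x)=0$), and put $$\overline\delta(\theta):=\log\langle v_\theta,w_\theta\rangle,\qquad \underline\delta(\theta):=\overline\delta(\theta)-\log\max_x v_\theta(x).$$ Let $W_\theta(x|\bar x):=\lambda_\theta^{-1}v_\theta(x)\tilde W_\theta(x|\bar x)v_\theta(\bar x)^{-1}$. For transition matrices $W,V$ with the same support let $\varphi(t)$ be the logarithm of the Perron–Frobenius eigenvalue of $W(x|\bar x)^{t}V(x|\bar x)^{1-t}$ (with entry $0$ off the support), and set $D(W\|V):=\varphi'(1)$ and $D_{1+s}(W\|V):=\varphi(1+s)/s$ for $s>0$. Let $\hat\theta=\hat\theta(r)$ be the smallest solution $\theta\in\mathbb R$ of $(\theta-1)\phi'(\theta)-\phi(\theta)=r$. Put $-\log x:=+\infty$ for $x\le 0$. Then $$\begin{aligned} &\sup_{0\le\theta<1}\frac{n(-\theta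 r-\phi(\theta))-\overline\delta(\theta)}{1-\theta}\\ \le{}&-\log\beta^{\det}_{e^{-nr}}(W_1^{\times n}\times P_1\|W_0^{\times n}\times P_0)\ \le\ -\log\beta_{e^{-nr}}(W_1^{\times n}\times P_1\|W_0^{\times n}\times P_0)\\ \overset{(a)}{\le}{}&\inf_{\bar\theta\ge0,\,s>0,\,\theta\in(0,1)}\frac1s\Bigl[n\bigl(\phi((1+s)\theta)-(1+s)\phi(\theta)\bigr)+\overline\delta((1+s)\theta)-(1+s)\underline\delta(\theta)\\ &\quad-(1+s)\log\Bigl(1-2\exp\Bigl(n\tfrac{-(1+\bar\theta)\phi(\theta)+\phi((1+\bar\theta)\theta-\bar\theta)-\bar\theta r}{1+\bar\theta}+\tfrac{-(1+\bar\theta)\underline\delta(\theta)+\overline\delta((1+\bar\theta)\theta-\bar\theta)}{1+\bar\theta}\Bigr)\Bigr)\Bigr], \end{aligned}$$ and, whenever $\hat\theta(r)$ exists, the last infimum is $$\begin{aligned} \overset{(b)}{\le}{}&\inf_{s>0,\,\theta\in(\hat\theta,1)}\frac1s\Bigl[n\bigl(\phi((1+s)\theta)-(1+s)\phi(\theta)\bigr)+\overline\delta((1+s)\theta)-(1+s)\underline\delta(\theta)\\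 &\quad-(1+s)\log\Bigl(1-2\exp\Bigl(n\bigl(-\phi(\theta)+\phi(\hat\theta)+(\theta-\hat\theta)\phi'(\hat\theta)\bigr)-\underline\delta(\theta)+\tfrac{(1-\theta)\overline\delta(\hat\theta)}{1-\hat\theta}\Bigr)\Bigr)\Bigr]\\ \overset{(c)}{=}{}&\inf_{s>0,\,\theta\in(\hat\theta,1)}nD_{1+s}(W_\theta\|W_0)+\frac1s\bigl(\overline\delta((1+s)\theta)-(1+s)\underline\delta(\theta)\bigr)\\ &\quad-\frac{1+s}s\log\Bigl(1-2\exp\Bigl(-nD(W_{\hat\theta}\|W_\theta)-\underline\delta(\theta)+\tfrac{(1-\theta)\overline\delta(\hat\theta)}{1-\hat\theta}\Bigr)\Bigr). \end{aligned}$$ -/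

import Mathlib

open scoped BigOperators Matrix

/-!
Throughout, a transition matrix is a `Matrix X X ℝ` with `W x y = W(x|y)`, the probability of
moving to `x` from `y`; its columns sum to one.
-/

noncomputable section

namespace MarkovTest

variable {X : Type*} [Fintype X]

/-- The Perron--Frobenius eigenvalue of an entrywise nonnegative square matrix: its largest
eigenvalue that has a nonzero, entrywise nonnegative eigenvector. -/
def perronRoot (A : Matrix X X ℝ) : ℝ :=
  sSup {l : ℝ | ∃ v : X → ℝ, (∀ x, 0 ≤ v x) ∧ v ≠ 0 ∧ A *ᵥ v = l • v}

/-- The Perron--Frobenius eigenvector of `A`: the strictly positive eigenvector for the eigenvalue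
`perronRoot A`, normalized to have smallest entry `1` (it exists and is unique if `A` is
irreducible). -/
def perronVec (A : Matrix X X ℝ) : X → ℝ :=
  Classical.epsilon fun v : X → ℝ =>
    (∀ x, 0 < v x) ∧ A *ᵥ v = perronRoot A • v ∧ (⨅ x, v x) = 1

/-- The tilted matrix `W₀(x|y) exp (θ g(x,y))`, where `g(x,y) = log (W₁(x|y) / W₀(x|y))`. -/
def tilted (W₀ W₁ : Matrix X X ℝ) (θ : ℝ) : Matrix X X ℝ :=
  Matrix.of fun x y => W₀ x y * Real.exp (θ * Real.log (W₁ x y / W₀ x y))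

/-- The potential function `φ(θ)`. -/
def phi (W₀ W₁ : Matrix X X ℝ) (θ : ℝ) : ℝ :=
  Real.log (perronRoot (tilted W₀ W₁ θ))

/-- The exponential family `W_θ` of transition matrices through `W₀` and `W₁`. -/
def expFamily (W₀ W₁ : Matrix X X ℝ) (θ : ℝ) : Matrix X X ℝ :=
  Matrix.of fun x y =>
    (perronRoot (tilted W₀ W₁ θ))⁻¹ * perronVec (tilted W₀ W₁ θ)ᵀ x * tilted W₀ W₁ θ x y *
      (perronVec (tilted W₀ W₁ θ)ᵀ y)⁻¹

/-- The logarithm of the Perron--Frobenius eigenvalue of `W(x|y)^t V(x|y)^(1-t)`. -/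
def renyiCumulant (W V : Matrix X X ℝ) (t : ℝ) : ℝ :=
  Real.log (perronRoot (Matrix.of fun x y => W x y ^ t * V x y ^ (1 - t)))

/-- The relative entropy `D(W‖V)` of transition matrices. -/
def relEntropy (W V : Matrix X X ℝ) : ℝ :=
  deriv (renyiCumulant W V) 1

/-- The relative Rényi entropy `D_{1+s}(W‖V)` of transition matrices, for `s ≠ 0`. -/
def relRenyi (s : ℝ) (W V : Matrix X X ℝ) : ℝ :=
  renyiCumulant W V (1 + s) / s

/-- The vector `w_θ(x) = P₀(x) exp (θ h(x))`, where `h(x) = log (P₁(x) / P₀(x))`. -/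
def initVec (P₀ P₁ : X → ℝ) (θ : ℝ) (x : X) : ℝ :=
  P₀ x * Real.exp (θ * Real.log (P₁ x / P₀ x))

/-- `δ̄(θ) = log ⟨v_θ, w_θ⟩`, with `v_θ` the Perron--Frobenius eigenvector of the transpose of the
tilted matrix, normalized by `min v_θ = 1`. -/
def deltaUpper (W₀ W₁ : Matrix X X ℝ) (P₀ P₁ : X → ℝ) (θ : ℝ) : ℝ :=
  Real.log (∑ x, perronVec (tilted W₀ W₁ θ)ᵀ x * initVec P₀ P₁ θ x)

/-- `δ̲(θ) = log ⟨v_θ, w_θ⟩ - log (max v_θ)`. -/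
def deltaLower (W₀ W₁ : Matrix X X ℝ) (P₀ P₁ : X → ℝ) (θ : ℝ) : ℝ :=
  deltaUpper W₀ W₁ P₀ P₁ θ - Real.log (⨆ x, perronVec (tilted W₀ W₁ θ)ᵀ x)

/-- The law `W^{×n} × P` of the Markov path `(X₁, …, X_{n+1})` (indexed by `0, …, n`) with initial
distribution `P` and transition matrix `W`. -/
def pathLaw (n : ℕ) (W : Matrix X X ℝ) (P : X → ℝ) (x : Fin (n + 1) → X) : ℝ :=
  P (x 0) * ∏ i : Fin n, W (x i.succ) (x i.castSucc)

variable {Ω : Type*} [Fintype Ω]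

/-- The optimal second-kind error `β_ε(Q₁‖Q₀)` over randomized tests `T : Ω → [0,1]`. -/
def betaRand (ε : ℝ) (Q₁ Q₀ : Ω → ℝ) : ℝ :=
  sInf {b : ℝ | ∃ T : Ω → ℝ, (∀ ω, 0 ≤ T ω ∧ T ω ≤ 1) ∧ ∑ ω, Q₁ ω * T ω ≤ ε ∧
    b = ∑ ω, Q₀ ω * (1 - T ω)}

/-- The optimal second-kind error `β_ε(Q₁‖Q₀)` over deterministic tests, with rejection region
`S ⊆ Ω`. -/
def betaDet (ε : ℝ) (Q₁ Q₀ : Ω → ℝ) : ℝ :=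
  sInf {b : ℝ | ∃ S : Finset Ω, ∑ ω ∈ S, Q₁ ω ≤ ε ∧ b = 1 - ∑ ω ∈ S, Q₀ ω}

/-- The logarithm with values in `[-∞, ∞]`, equal to `-∞` on `(-∞, 0]`. -/
def elog (x : ℝ) : EReal := ENNReal.log (ENNReal.ofReal x)

section Bounds

variable (W₀ W₁ : Matrix X X ℝ) (P₀ P₁ : X → ℝ) (n : ℕ)

/-- The lower bound: the supremum over `0 ≤ θ < 1` of `(n (-θ r - φ(θ)) - δ̄(θ)) / (1 - θ)`. -/
def lowerBound (r : ℝ) : EReal :=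
  ⨆ (θ : ℝ) (_ : θ ∈ Set.Ico (0 : ℝ) 1),
    (((n * (-(θ * r) - phi W₀ W₁ θ) - deltaUpper W₀ W₁ P₀ P₁ θ) / (1 - θ) : ℝ) : EReal)

/-- The first upper bound: the infimum over `θb ≥ 0`, `s > 0` and `0 < θ < 1`. -/
def upperBoundA (r : ℝ) : EReal :=
  ⨅ (θb : ℝ) (_ : 0 ≤ θb) (s : ℝ) (_ : 0 < s) (θ : ℝ) (_ : θ ∈ Set.Ioo (0 : ℝ) 1),
    ((1 / s : ℝ) : EReal) *
      (((n * (phi W₀ W₁ ((1 + s) * θ) - (1 + s) * phi W₀ W₁ θ)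
          + (deltaUpper W₀ W₁ P₀ P₁ ((1 + s) * θ) - (1 + s) * deltaLower W₀ W₁ P₀ P₁ θ) : ℝ) : EReal)
        - ((1 + s : ℝ) : EReal) * elog (1 - 2 * Real.exp
          (n * ((-(1 + θb) * phi W₀ W₁ θ + phi W₀ W₁ ((1 + θb) * θ - θb) - θb * r) / (1 + θb))
            + (-(1 + θb) * deltaLower W₀ W₁ P₀ P₁ θ
                + deltaUpper W₀ W₁ P₀ P₁ ((1 + θb) * θ - θb)) / (1 + θb))))

/-- The second upper bound: the infimum over `s > 0` and `θh < θ < 1`. -/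
def upperBoundB (θh : ℝ) : EReal :=
  ⨅ (s : ℝ) (_ : 0 < s) (θ : ℝ) (_ : θ ∈ Set.Ioo θh 1),
    ((1 / s : ℝ) : EReal) *
      (((n * (phi W₀ W₁ ((1 + s) * θ) - (1 + s) * phi W₀ W₁ θ)
          + (deltaUpper W₀ W₁ P₀ P₁ ((1 + s) * θ) - (1 + s) * deltaLower W₀ W₁ P₀ P₁ θ) : ℝ) : EReal)
        - ((1 + s : ℝ) : EReal) * elog (1 - 2 * Real.exp
          (n * (-phi W₀ W₁ θ + phi W₀ W₁ θh + (θ - θh) * deriv (phi W₀ W₁) θh)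
            - deltaLower W₀ W₁ P₀ P₁ θ
            + (1 - θ) * deltaUpper W₀ W₁ P₀ P₁ θh / (1 - θh))))

/-- The third upper bound, in terms of the relative entropies `D_{1+s}(W_θ‖W₀)` and
`D(W_{θh}‖W_θ)`: the infimum over `s > 0` and `θh < θ < 1`. -/
def upperBoundC (θh : ℝ) : EReal :=
  ⨅ (s : ℝ) (_ : 0 < s) (θ : ℝ) (_ : θ ∈ Set.Ioo θh 1),
    ((n * relRenyi s (expFamily W₀ W₁ θ) W₀
        + 1 / s * (deltaUpper W₀ W₁ P₀ P₁ ((1 + s) * θ)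
            - (1 + s) * deltaLower W₀ W₁ P₀ P₁ θ) : ℝ) : EReal)
      - (((1 + s) / s : ℝ) : EReal) * elog (1 - 2 * Real.exp
          (-(n * relEntropy (expFamily W₀ W₁ θh) (expFamily W₀ W₁ θ))
            - deltaLower W₀ W₁ P₀ P₁ θ
            + (1 - θ) * deltaUpper W₀ W₁ P₀ P₁ θh / (1 - θh)))

end Bounds

/-- `θh` is `θ̂(r)`: the smallest solution of `(θ - 1) φ'(θ) - φ(θ) = r`. -/
def IsThetaHat (W₀ W₁ : Matrix X X ℝ) (r θh : ℝ) : Prop :=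
  IsLeast {θ : ℝ | (θ - 1) * deriv (phi W₀ W₁) θ - phi W₀ W₁ θ = r} θh

end MarkovTest

end

/-!
The path laws `Q₀`, `Q₁` of the two chains span a finite exponential family: with `h` the
log-likelihood ratio `pathLogRatio`, the tilted weight `Q₀ exp (θ h)` of a path factorizes as the
path weight of the tilted matrix started from the tilted vector (`pathLaw_tilted`). Pairing with the
left Perron--Frobenius eigenvector, whose entries lie between `1` and its maximum, gives
`n φ(θ) + δ̲(θ) ≤ log M(θ) ≤ n φ(θ) + δ̄(θ)` for the total weight `M(θ)` (`exp_le_sum_path`,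
`sum_path_le_exp`).

What remains about testing is a statement on finite exponential families. The lower bound is the
Chernoff bound for a likelihood-ratio test (`betaDet_le`). For the first upper bound, fix a test
`T`. By Hölder's inequality, `θ ↦ log ∑ w exp (θ h)` is convex for any nonnegative weights `w`
(`sum_exp_le_rpow_mul_rpow`). With `w = Q₀ T`, interpolating `θ` between `(1 + θ̄) θ - θ̄` and `1`
bounds the tilted weight of `T` by the first-kind error. With `w = Q₀ (1 - T)`, interpolating `θ`
between `(1 + s) θ` and `0` then bounds the second-kind error from below
(`neg_elog_betaRand_le`).

For the second upper bound and `θ > 0`, the choice `θ̄ = (θ - θ̂) / (1 - θ)` turns the terms of the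
first into those of the second. If `θ̂ < 0`, then `θ ≤ 0` is allowed in the second infimum but not in
the first. Such terms are compared with the limit of the terms of the first infimum as `θ → 0⁺` with
`θ̄ = -θ̂` (`upperBoundA_le_limit`), using convexity between `θ̂` and `0` (`lower_le_mul_upper`).
The third bound equals the second since `W_θ` is a diagonal conjugate of a multiple of the tilted
matrix, which expresses the Rényi cumulants through `φ` (`renyiCumulant_expFamily`).

The last two points need that the Perron--Frobenius eigenvector depends continuously, and the
eigenvalue differentiably, on the parameter. The normalized eigenvector is a map into the compact
simplex with closed graph, hence continuous; for left and right eigenvectors `v`, `u'` of `A`, `A'`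
the identity `(λ' - λ) ⟨v, u'⟩ = ⟨v, (A' - A) u'⟩` (`left_right_eigen`) then gives the derivative.
-/

noncomputable section

namespace MarkovTest

/-! ### Perron--Frobenius theory -/

/-- The pairing of a left eigenvector of `B` with a right eigenvector of `A` compares the two
eigenvalues. For `A = B` it shows that they agree. -/
lemma left_right_eigen {X : Type*} [Fintype X] {A B : Matrix X X ℝ} {l m : ℝ} {v u : X → ℝ}
    (hv : Bᵀ *ᵥ v = l • v) (hu : A *ᵥ u = m • u) :
    (m - l) * ∑ x, v x * u x = ∑ x, ∑ y, v x * (A x y - B x y) * u y := by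
  have h1 : v ⬝ᵥ (A *ᵥ u) = m * (v ⬝ᵥ u) := by rw [hu, dotProduct_smul, smul_eq_mul]
  have h2 : v ⬝ᵥ (B *ᵥ u) = l * (v ⬝ᵥ u) := by
    rw [Matrix.dotProduct_mulVec, ← Matrix.mulVec_transpose, hv, smul_dotProduct, smul_eq_mul]
  have h3 : (m - l) * (v ⬝ᵥ u) = v ⬝ᵥ ((A - B) *ᵥ u) := by
    rw [Matrix.sub_mulVec, dotProduct_sub, h1, h2]; ring
  change (m - l) * (v ⬝ᵥ u) = _
  rw [h3]
  simp only [dotProduct, Matrix.mulVec, Finset.mul_sum, Matrix.sub_apply, mul_assoc]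

/-- Irreducibility of a nonnegative matrix depends only on its support. -/
lemma isIrreducible_congr_support {X : Type*} {A B : Matrix X X ℝ} (hA : A.IsIrreducible)
    (hB : ∀ i j, 0 ≤ B i j) (h : ∀ i j, A i j = 0 ↔ B i j = 0) : B.IsIrreducible := by
  have hq : A.toQuiver = B.toQuiver := by
    unfold Matrix.toQuiver
    congr 1
    funext i j
    have : (0 < A i j) = (0 < B i j) := by
      rw [(hA.nonneg i j).lt_iff_ne, (hB i j).lt_iff_ne, ne_comm, ne_comm (a := (0:ℝ)), Ne, Ne, h]
    rw [this]
  refine ⟨hB, ?_⟩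
  rw [← hq]
  exact hA.connected

section PerronFrobenius

variable {X : Type*} [Fintype X] [DecidableEq X] {A : Matrix X X ℝ}

lemma pow_mulVec_eigen {l : ℝ} {v : X → ℝ} (h : A *ᵥ v = l • v) (k : ℕ) :
    (A ^ k) *ᵥ v = l ^ k • v := by
  induction k with
  | zero => simp
  | succ k ih => rw [pow_succ, ← Matrix.mulVec_mulVec, h, Matrix.mulVec_smul, ih, smul_smul,
      pow_succ, mul_comm]

/-- Irreducibility spreads positivity of one entry to all entries through `A ^ k *ᵥ v = l ^ k • v`. -/
lemma eigen_pos (hA : A.IsIrreducible) {l : ℝ} {v : X → ℝ} (hv : ∀ x, 0 ≤ v x) (hv0 : v ≠ 0)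
    (h : A *ᵥ v = l • v) : 0 < l ∧ ∀ x, 0 < v x := by
  obtain ⟨j, hj⟩ : ∃ j, v j ≠ 0 := Function.ne_iff.mp hv0
  have hj : 0 < v j := lt_of_le_of_ne (hv j) (Ne.symm hj)
  have hl0 : 0 ≤ l := by
    have h1 : 0 ≤ (A *ᵥ v) j := Finset.sum_nonneg fun i _ => mul_nonneg (hA.nonneg j i) (hv i)
    rw [h] at h1
    exact nonneg_of_mul_nonneg_left h1 hj
  have key : ∀ i, ∃ k > 0, 0 < l ^ k * v i := by
    intro i
    obtain ⟨k, hk, hp⟩ := (Matrix.isIrreducible_iff_exists_pow_pos hA.nonneg).1 hA i j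
    refine ⟨k, hk, ?_⟩
    have h2 := congrFun (pow_mulVec_eigen h k) i
    simp only [Pi.smul_apply, smul_eq_mul] at h2
    rw [← h2]
    exact Finset.sum_pos' (fun m _ => mul_nonneg (Matrix.pow_apply_nonneg hA.nonneg k i m) (hv m))
      ⟨j, Finset.mem_univ j, mul_pos hp hj⟩
  constructor
  · obtain ⟨k, hk, hp⟩ := key j
    refine lt_of_le_of_ne hl0 fun h0 => ?_
    rw [← h0, zero_pow hk.ne', zero_mul] at hp
    exact hp.false
  · intro i
    obtain ⟨k, hk, hp⟩ := key i
    exact pos_of_mul_pos_right hp (pow_nonneg hl0 k)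

/-- A sum of powers of an irreducible matrix is entrywise positive. -/
lemma exists_pos_commute (hA : A.IsIrreducible) :
    ∃ B : Matrix X X ℝ, Commute A B ∧ ∀ i j, 0 < B i j := by
  choose k hk hp using (Matrix.isIrreducible_iff_exists_pow_pos hA.nonneg).1 hA
  refine ⟨∑ i, ∑ j, A ^ k i j, ?_, fun i j => ?_⟩
  · exact Commute.sum_right _ _ _ fun i _ => Commute.sum_right _ _ _ fun j _ =>
      (Commute.refl A).pow_right _
  · have hnn : ∀ a b, 0 ≤ (A ^ k a b) i j := fun a b => Matrix.pow_apply_nonneg hA.nonneg _ i j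
    simp only [Matrix.sum_apply]
    refine Finset.sum_pos' (fun a _ => Finset.sum_nonneg fun b _ => hnn a b)
      ⟨i, Finset.mem_univ i, ?_⟩
    exact Finset.sum_pos' (fun b _ => hnn i b) ⟨j, Finset.mem_univ j, hp i j⟩

/-- Existence in the Perron--Frobenius theorem. A nonnegative `v` with `ρ v ≤ A v` and `ρ` as large as
possible is an eigenvector: otherwise a positive matrix commuting with `A` makes the inequality
strict in all entries, and `ρ` could be increased. -/
lemma exists_eigen [Nonempty X] (hA : A.IsIrreducible) :
    ∃ (l : ℝ) (v : X → ℝ), (∀ x, 0 < v x) ∧ A *ᵥ v = l • v := by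
  set R : ℝ := ∑ i, ∑ j, A i j with hR
  -- the bound on the growth rates
  have hbound : ∀ (v : X → ℝ) (ρ : ℝ), v ∈ stdSimplex ℝ X → (∀ x, ρ * v x ≤ (A *ᵥ v) x) →
      ρ ≤ R := by
    intro v ρ hv h
    have h1 : ∑ x, ρ * v x ≤ ∑ x, (A *ᵥ v) x := Finset.sum_le_sum fun x _ => h x
    rw [← Finset.mul_sum, hv.2, mul_one] at h1
    refine h1.trans (Finset.sum_le_sum fun i _ => Finset.sum_le_sum fun j _ => ?_)
    have : v j ≤ 1 := hv.2 ▸ Finset.single_le_sum (fun x _ => hv.1 x) (Finset.mem_univ j)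
    exact mul_le_of_le_one_right (hA.nonneg i j) this
  have hR0 : 0 ≤ R := Finset.sum_nonneg fun i _ => Finset.sum_nonneg fun j _ => hA.nonneg i j
  let K : Set ((X → ℝ) × ℝ) :=
    (stdSimplex ℝ X ×ˢ Set.Icc 0 R) ∩ {p | ∀ x, p.2 * p.1 x ≤ (A *ᵥ p.1) x}
  have hK : IsCompact K := by
    refine ((isCompact_stdSimplex ℝ X).prod isCompact_Icc).inter_right ?_
    simp only [Set.ofPred_forall]
    refine isClosed_iInter fun x => isClosed_le (by fun_prop) ?_
    simp only [Matrix.mulVec, dotProduct]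
    fun_prop
  have hne : K.Nonempty := by
    obtain ⟨x⟩ := ‹Nonempty X›
    refine ⟨(Pi.single x 1, 0), ⟨single_mem_stdSimplex ℝ x, ⟨le_rfl, hR0⟩⟩, fun y => ?_⟩
    simpa using hA.nonneg y x
  obtain ⟨⟨v, ρ⟩, ⟨⟨hv, hρ⟩, hvρ⟩, hmax⟩ := hK.exists_isMaxOn hne continuous_snd.continuousOn
  have hv0 : v ≠ 0 := by
    rintro rfl
    have := hv.2
    simp at this
  have heig : A *ᵥ v = ρ • v := by
    by_contra hcon
    obtain ⟨B, hcomm, hB⟩ := exists_pos_commute hA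
    have hBpos : ∀ z : X → ℝ, (∀ x, 0 ≤ z x) → z ≠ 0 → ∀ x, 0 < (B *ᵥ z) x := by
      intro z hz hz0 x
      obtain ⟨j, hj⟩ : ∃ j, z j ≠ 0 := Function.ne_iff.mp hz0
      exact Finset.sum_pos' (fun i _ => mul_nonneg (hB x i).le (hz i))
        ⟨j, Finset.mem_univ j, mul_pos (hB x j) (lt_of_le_of_ne (hz j) (Ne.symm hj))⟩
    set y := B *ᵥ v with hy
    have hypos : ∀ x, 0 < y x := hBpos v hv.1 hv0
    set z := B *ᵥ (A *ᵥ v - ρ • v) with hz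
    have hzpos : ∀ x, 0 < z x := hBpos _ (fun x => by
      have := hvρ x
      simpa using this) (sub_ne_zero.2 hcon)
    have hzy : z = A *ᵥ y - ρ • y := by
      rw [hz, hy, Matrix.mulVec_sub, Matrix.mulVec_smul, Matrix.mulVec_mulVec,
        Matrix.mulVec_mulVec, hcomm.eq]
    obtain ⟨x₀, hx₀⟩ := Finite.exists_min fun x => z x / y x
    set ε := z x₀ / y x₀
    have hε : 0 < ε := div_pos (hzpos x₀) (hypos x₀)
    set S := ∑ x, y x with hS
    have hSpos : 0 < S := Finset.sum_pos (fun x _ => hypos x) Finset.univ_nonempty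
    have hmem : S⁻¹ • y ∈ stdSimplex ℝ X := by
      refine ⟨fun x => mul_nonneg (inv_nonneg.2 hSpos.le) (hypos x).le, ?_⟩
      simp only [Pi.smul_apply, smul_eq_mul, ← Finset.mul_sum]
      exact inv_mul_cancel₀ hSpos.ne'
    have hle : ∀ x, (ρ + ε) * (S⁻¹ • y) x ≤ (A *ᵥ (S⁻¹ • y)) x := by
      intro x
      have h1 : ε * y x ≤ z x := (le_div_iff₀ (hypos x)).1 (hx₀ x)
      have h2 : (A *ᵥ y) x = z x + ρ * y x := by rw [hzy]; simp
      rw [Matrix.mulVec_smul, Pi.smul_apply, Pi.smul_apply, smul_eq_mul, smul_eq_mul, h2]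
      have h3 : S⁻¹ * (ε * y x) ≤ S⁻¹ * z x := mul_le_mul_of_nonneg_left h1 (inv_nonneg.2 hSpos.le)
      linarith
    have := hmax (a := (S⁻¹ • y, ρ + ε))
      ⟨⟨hmem, ⟨by linarith [hρ.1], hbound _ _ hmem hle⟩⟩, hle⟩
    have h4 : ρ + ε ≤ ρ := this
    linarith
  exact ⟨ρ, v, (eigen_pos hA hv.1 hv0 heig).2, heig⟩

lemma eigenvalue_unique (hA : A.IsIrreducible) {l m : ℝ} {v u : X → ℝ}
    (hv : ∀ x, 0 ≤ v x) (hv0 : v ≠ 0) (hvl : A *ᵥ v = l • v)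
    (hu : ∀ x, 0 ≤ u x) (hu0 : u ≠ 0) (hum : A *ᵥ u = m • u) : l = m := by
  have : Nonempty X := by
    obtain ⟨j, -⟩ := Function.ne_iff.mp hv0
    exact ⟨j⟩
  obtain ⟨k, w, hw, hwk⟩ := exists_eigen hA.transpose
  have key : ∀ {l : ℝ} {v : X → ℝ}, (∀ x, 0 ≤ v x) → v ≠ 0 → A *ᵥ v = l • v → l = k := by
    intro l v hv hv0 hvl
    have h := left_right_eigen hwk hvl
    simp only [sub_self, mul_zero, zero_mul, Finset.sum_const_zero] at h
    have hpos : 0 < ∑ x, w x * v x := Finset.sum_pos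
      (fun x _ => mul_pos (hw x) ((eigen_pos hA hv hv0 hvl).2 x)) Finset.univ_nonempty
    rcases mul_eq_zero.1 h with h | h
    · linarith
    · exact absurd h hpos.ne'
  rw [key hv hv0 hvl, key hu hu0 hum]

lemma perronRoot_eq (hA : A.IsIrreducible) {l : ℝ} {v : X → ℝ}
    (hv : ∀ x, 0 ≤ v x) (hv0 : v ≠ 0) (h : A *ᵥ v = l • v) : perronRoot A = l := by
  have : {l : ℝ | ∃ v : X → ℝ, (∀ x, 0 ≤ v x) ∧ v ≠ 0 ∧ A *ᵥ v = l • v} = {l} := by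
    ext m
    constructor
    · rintro ⟨u, hu, hu0, hum⟩
      exact eigenvalue_unique hA hu hu0 hum hv hv0 h
    · rintro rfl
      exact ⟨v, hv, hv0, h⟩
  rw [perronRoot, this, csSup_singleton]

/-- The largest multiple of `u` below `v` touches `v`; the difference is a nonnegative eigenvector with
a zero entry, so it vanishes. -/
lemma eigenvector_unique (hA : A.IsIrreducible) {l m : ℝ} {v u : X → ℝ}
    (hv : ∀ x, 0 < v x) (hvl : A *ᵥ v = l • v) (hu : ∀ x, 0 < u x) (hum : A *ᵥ u = m • u) :
    ∃ c : ℝ, 0 < c ∧ v = c • u := by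
  rcases isEmpty_or_nonempty X with hX | hX
  · exact ⟨1, one_pos, Subsingleton.elim _ _⟩
  have hne : ∀ {w : X → ℝ}, (∀ x, 0 < w x) → w ≠ 0 := by
    rintro w hw rfl
    exact (hw (Classical.arbitrary X)).false
  have hlm : l = m := eigenvalue_unique hA (fun x => (hv x).le) (hne hv) hvl
    (fun x => (hu x).le) (hne hu) hum
  subst hlm
  obtain ⟨x₀, hx₀⟩ := Finite.exists_min fun x => v x / u x
  refine ⟨v x₀ / u x₀, div_pos (hv x₀) (hu x₀), ?_⟩
  by_contra hcon
  have h := eigen_pos hA (v := v - (v x₀ / u x₀) • u) (l := l) (fun x => by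
    have := (le_div_iff₀ (hu x)).1 (hx₀ x)
    simpa using this) (sub_ne_zero.2 hcon)
    (by rw [Matrix.mulVec_sub, Matrix.mulVec_smul, hvl, hum, smul_sub, smul_comm])
  have := h.2 x₀
  simp [(hu x₀).ne'] at this

lemma perronVec_spec [Nonempty X] (hA : A.IsIrreducible) :
    (∀ x, 0 < perronVec A x) ∧ A *ᵥ perronVec A = perronRoot A • perronVec A ∧
      (⨅ x, perronVec A x) = 1 := by
  obtain ⟨l, v, hv, hvl⟩ := exists_eigen hA
  have hl := perronRoot_eq hA (fun x => (hv x).le)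
    (fun h => (hv (Classical.arbitrary X)).ne' (congrFun h _)) hvl
  obtain ⟨x₀, hx₀⟩ := exists_eq_ciInf_of_finite (f := v)
  have hc : 0 < ⨅ x, v x := hx₀ ▸ hv x₀
  refine Classical.epsilon_spec (p := fun v : X → ℝ =>
    (∀ x, 0 < v x) ∧ A *ᵥ v = perronRoot A • v ∧ (⨅ x, v x) = 1)
    ⟨(⨅ x, v x)⁻¹ • v, fun x => mul_pos (inv_pos.2 hc) (hv x), ?_, ?_⟩
  · rw [Matrix.mulVec_smul, hvl, hl, smul_comm]
  · simp only [Pi.smul_apply, smul_eq_mul]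
    rw [← Real.mul_iInf_of_nonneg (inv_nonneg.2 hc.le), inv_mul_cancel₀ hc.ne']

lemma perronVec_pos [Nonempty X] (hA : A.IsIrreducible) (x : X) : 0 < perronVec A x :=
  (perronVec_spec hA).1 x

lemma mulVec_perronVec [Nonempty X] (hA : A.IsIrreducible) :
    A *ᵥ perronVec A = perronRoot A • perronVec A :=
  (perronVec_spec hA).2.1

lemma one_le_perronVec [Nonempty X] (hA : A.IsIrreducible) (x : X) : 1 ≤ perronVec A x := by
  rw [← (perronVec_spec hA).2.2]
  exact ciInf_le (Set.finite_range _).bddBelow x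

lemma perronVec_ne_zero [Nonempty X] (hA : A.IsIrreducible) : perronVec A ≠ 0 :=
  fun h => (perronVec_pos hA (Classical.arbitrary X)).ne' (congrFun h _)

lemma perronRoot_pos [Nonempty X] (hA : A.IsIrreducible) : 0 < perronRoot A :=
  (eigen_pos hA (fun x => (perronVec_pos hA x).le) (perronVec_ne_zero hA)
    (mulVec_perronVec hA)).1

lemma perronVec_eq [Nonempty X] (hA : A.IsIrreducible) {l : ℝ} {v : X → ℝ} (hv : ∀ x, 0 < v x)
    (h : A *ᵥ v = l • v) (hinf : (⨅ x, v x) = 1) : perronVec A = v := by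
  obtain ⟨c, hc, hcv⟩ := eigenvector_unique hA (perronVec_pos hA) (mulVec_perronVec hA) hv h
  have h1 : (⨅ x, (c • v) x) = 1 := hcv ▸ (perronVec_spec hA).2.2
  simp only [Pi.smul_apply, smul_eq_mul] at h1
  rw [← Real.mul_iInf_of_nonneg hc.le, hinf, mul_one] at h1
  rw [hcv, h1, one_smul]

lemma perronRoot_transpose [Nonempty X] (hA : A.IsIrreducible) :
    perronRoot Aᵀ = perronRoot A := by
  have h := left_right_eigen (mulVec_perronVec hA.transpose) (mulVec_perronVec hA)
  simp only [sub_self, mul_zero, zero_mul, Finset.sum_const_zero] at h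
  have hpos : 0 < ∑ x, perronVec Aᵀ x * perronVec A x := Finset.sum_pos
    (fun x _ => mul_pos (perronVec_pos hA.transpose x) (perronVec_pos hA x)) Finset.univ_nonempty
  rcases mul_eq_zero.1 h with h | h
  · linarith
  · exact absurd h hpos.ne'

/-! ### Dependence of the eigenvector and the eigenvalue on a parameter -/

section Family

variable {T : Type*} [TopologicalSpace T] [Nonempty X] {F : T → Matrix X X ℝ}

/-- The eigenvector normalized to sum `1` is the only point `w` of the simplex with
`A w = (∑ A w) w`. This equation is closed in the parameter and `w`, and the simplex is compact. -/
lemma continuous_normalized_perronVec (hF : ∀ t, (F t).IsIrreducible) (hc : Continuous F) :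
    Continuous fun t => (∑ x, perronVec (F t) x)⁻¹ • perronVec (F t) := by
  have hS : ∀ t, 0 < ∑ x, perronVec (F t) x := fun t =>
    Finset.sum_pos (fun x _ => perronVec_pos (hF t) x) Finset.univ_nonempty
  have hmem : ∀ t, (∑ x, perronVec (F t) x)⁻¹ • perronVec (F t) ∈ stdSimplex ℝ X := by
    intro t
    refine ⟨fun x => mul_nonneg (inv_nonneg.2 (hS t).le) (perronVec_pos (hF t) x).le, ?_⟩
    simp only [Pi.smul_apply, smul_eq_mul, ← Finset.mul_sum]
    exact inv_mul_cancel₀ (hS t).ne'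
  let u : T → stdSimplex ℝ X := fun t => ⟨_, hmem t⟩
  have hgraph : {p : T × stdSimplex ℝ X | u p.1 = p.2} =
      {p | F p.1 *ᵥ p.2.1 = (∑ x, (F p.1 *ᵥ p.2.1) x) • p.2.1} := by
    ext ⟨t, w, hw⟩
    simp only [Set.mem_ofPred_eq]
    constructor
    · intro h
      have h' : w = (∑ x, perronVec (F t) x)⁻¹ • perronVec (F t) := (congrArg Subtype.val h).symm
      have h1 : F t *ᵥ w = perronRoot (F t) • w := by
        rw [h', Matrix.mulVec_smul, mulVec_perronVec (hF t), smul_comm]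
      have h2 : ∑ x, (F t *ᵥ w) x = perronRoot (F t) := by
        rw [h1]
        simp only [Pi.smul_apply, smul_eq_mul, ← Finset.mul_sum]
        rw [hw.2, mul_one]
      rw [h2, h1]
    · intro h
      have hw0 : w ≠ 0 := by
        rintro rfl
        have := hw.2
        simp at this
      obtain ⟨c, hc, hcv⟩ := eigenvector_unique (hF t) (eigen_pos (hF t) hw.1 hw0 h).2 h
        (perronVec_pos (hF t)) (mulVec_perronVec (hF t))
      have h3 : c * ∑ x, perronVec (F t) x = 1 := by
        rw [← hw.2, hcv]
        simp only [Pi.smul_apply, smul_eq_mul, ← Finset.mul_sum]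
      refine Subtype.ext ?_
      change (∑ x, perronVec (F t) x)⁻¹ • perronVec (F t) = w
      rw [hcv, eq_inv_of_mul_eq_one_left h3]
  have hclosed : IsClosed {p : T × stdSimplex ℝ X | u p.1 = p.2} := by
    rw [hgraph]
    have hw : Continuous fun p : T × stdSimplex ℝ X => p.2.1 := by fun_prop
    have hm : Continuous fun p : T × stdSimplex ℝ X => F p.1 *ᵥ p.2.1 :=
      (hc.comp continuous_fst).matrix_mulVec hw
    refine isClosed_eq hm (Continuous.fun_smul ?_ hw)
    exact continuous_finsetSum _ fun x _ => (continuous_apply x).comp hm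
  have hu : Continuous u := by
    rw [continuous_iff_isClosed]
    intro C hC
    have : u ⁻¹' C = Prod.fst '' ({p : T × stdSimplex ℝ X | u p.1 = p.2} ∩ Prod.snd ⁻¹' C) := by
      ext t
      simp
    rw [this]
    exact isClosedMap_fst_of_compactSpace _ (hclosed.inter (hC.preimage continuous_snd))
  exact continuous_subtype_val.comp hu

lemma continuous_perronVec (hF : ∀ t, (F t).IsIrreducible) (hc : Continuous F) :
    Continuous fun t => perronVec (F t) := by
  set u : T → X → ℝ := fun t => (∑ x, perronVec (F t) x)⁻¹ • perronVec (F t) with hu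
  have hcu : Continuous u := continuous_normalized_perronVec hF hc
  have hS : ∀ t, 0 < ∑ x, perronVec (F t) x := fun t =>
    Finset.sum_pos (fun x _ => perronVec_pos (hF t) x) Finset.univ_nonempty
  have hinf : ∀ t, (⨅ x, u t x) = (∑ x, perronVec (F t) x)⁻¹ := by
    intro t
    simp only [hu, Pi.smul_apply, smul_eq_mul]
    rw [← Real.mul_iInf_of_nonneg (inv_nonneg.2 (hS t).le), (perronVec_spec (hF t)).2.2, mul_one]
  have hcinf : Continuous fun t => ⨅ x, u t x := by
    simp only [← Finset.inf'_univ_eq_ciInf]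
    exact Continuous.finset_inf'_apply _ fun x _ => (continuous_apply x).comp hcu
  have heq : (fun t => perronVec (F t)) = fun t => (⨅ x, u t x)⁻¹ • u t := by
    funext t
    rw [hinf, inv_inv, hu, smul_smul, mul_inv_cancel₀ (hS t).ne', one_smul]
  rw [heq]
  exact (hcinf.inv₀ fun t => by rw [hinf]; exact (inv_pos.2 (hS t)).ne').smul hcu

end Family

/-- First-order perturbation of the Perron--Frobenius eigenvalue: the slope is an exact quotient of
pairings, whose limit follows from continuity of the right eigenvector. -/
lemma hasDerivAt_perronRoot [Nonempty X] {F : ℝ → Matrix X X ℝ} {F' : Matrix X X ℝ} {t : ℝ}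
    (hF : ∀ t, (F t).IsIrreducible) (hc : Continuous F)
    (hd : ∀ x y, HasDerivAt (fun t => F t x y) (F' x y) t) :
    HasDerivAt (fun t => perronRoot (F t))
      ((∑ x, ∑ y, perronVec (F t)ᵀ x * F' x y * perronVec (F t) y) /
        ∑ x, perronVec (F t)ᵀ x * perronVec (F t) x) t := by
  have hpos : ∀ s, 0 < ∑ x, perronVec (F t)ᵀ x * perronVec (F s) x := fun s => Finset.sum_pos
    (fun x _ => mul_pos (perronVec_pos (hF t).transpose x) (perronVec_pos (hF s) x))
    Finset.univ_nonempty
  have hcv : ∀ y, Continuous fun s => perronVec (F s) y := fun y =>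
    (continuous_apply y).comp (continuous_perronVec hF hc)
  rw [hasDerivAt_iff_tendsto_slope]
  have heq : ∀ s, slope (fun t => perronRoot (F t)) t s =
      (∑ x, ∑ y, perronVec (F t)ᵀ x * slope (fun t => F t x y) t s * perronVec (F s) y) /
        ∑ x, perronVec (F t)ᵀ x * perronVec (F s) x := by
    intro s
    have h := left_right_eigen (mulVec_perronVec (hF t).transpose) (mulVec_perronVec (hF s))
    rw [perronRoot_transpose (hF t)] at h
    rw [eq_div_iff (hpos s).ne', slope_def_field, div_mul_eq_mul_div, h, Finset.sum_div]
    refine Finset.sum_congr rfl fun x _ => ?_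
    rw [Finset.sum_div]
    refine Finset.sum_congr rfl fun y _ => ?_
    rw [slope_def_field]
    ring
  refine Filter.Tendsto.congr (fun s => (heq s).symm) ?_
  refine Filter.Tendsto.div ?_ ?_ (hpos t).ne'
  · refine tendsto_finsetSum _ fun x _ => tendsto_finsetSum _ fun y _ => ?_
    exact (tendsto_const_nhds.mul (hasDerivAt_iff_tendsto_slope.1 (hd x y))).mul
      ((hcv y).tendsto t |>.mono_left nhdsWithin_le_nhds)
  · refine tendsto_finsetSum _ fun x _ => tendsto_const_nhds.mul ?_
    exact (hcv x).tendsto t |>.mono_left nhdsWithin_le_nhds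

end PerronFrobenius

/-! ### The tilted matrices and the potential function -/

section Tilting

variable {X : Type*}

lemma tilted_zero (W₀ W₁ : Matrix X X ℝ) : tilted W₀ W₁ 0 = W₀ := by
  ext x y
  simp [tilted]

/-- The hypothesis on the zeros makes the junk value `b / 0 = 0` harmless. -/
lemma mul_exp_log_div {a b : ℝ} (ha : 0 ≤ a) (hb : 0 ≤ b) (h : a = 0 ↔ b = 0) :
    a * Real.exp (Real.log (b / a)) = b := by
  rcases ha.eq_or_lt with h0 | h0
  · rw [h.1 h0.symm, ← h0, zero_mul]
  · have hb0 : 0 < b := lt_of_le_of_ne hb fun h1 => h0.ne' (h.2 h1.symm)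
    rw [Real.exp_log (div_pos hb0 h0), mul_div_cancel₀ _ h0.ne']

lemma tilted_one {W₀ W₁ : Matrix X X ℝ} (h₀ : W₀.IsIrreducible) (h₁ : W₁.IsIrreducible)
    (hs : ∀ x y, W₀ x y = 0 ↔ W₁ x y = 0) : tilted W₀ W₁ 1 = W₁ := by
  ext x y
  simp only [tilted, Matrix.of_apply, one_mul]
  exact mul_exp_log_div (h₀.nonneg x y) (h₁.nonneg x y) (hs x y)

lemma tilted_irreducible {W₀ : Matrix X X ℝ} (h₀ : W₀.IsIrreducible) (W₁ : Matrix X X ℝ) (θ : ℝ) :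
    (tilted W₀ W₁ θ).IsIrreducible :=
  isIrreducible_congr_support h₀
    (fun x y => mul_nonneg (h₀.nonneg x y) (Real.exp_pos _).le)
    fun x y => by simp [tilted, (Real.exp_pos _).ne']

lemma continuous_tilted (W₀ W₁ : Matrix X X ℝ) : Continuous (tilted W₀ W₁) := by
  refine continuous_matrix fun x y => ?_
  simp only [tilted, Matrix.of_apply]
  fun_prop

variable [Fintype X] [DecidableEq X]

lemma differentiable_phi [Nonempty X] {W₀ : Matrix X X ℝ} (h₀ : W₀.IsIrreducible)
    (W₁ : Matrix X X ℝ) : Differentiable ℝ (phi W₀ W₁) := by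
  intro θ
  have hd : ∀ x y, HasDerivAt (fun t => tilted W₀ W₁ t x y)
      ((Matrix.of fun x y => W₀ x y * (Real.exp (θ * Real.log (W₁ x y / W₀ x y)) *
        (1 * Real.log (W₁ x y / W₀ x y))) : Matrix X X ℝ) x y) θ := fun x y =>
    ((hasDerivAt_id θ).mul_const _).exp.const_mul _
  exact (hasDerivAt_perronRoot (tilted_irreducible h₀ W₁)
    (continuous_tilted W₀ W₁) hd).differentiableAt.log
    (perronRoot_pos (tilted_irreducible h₀ W₁ θ)).ne'

lemma continuous_perronVec_tilted [Nonempty X] {W₀ : Matrix X X ℝ} (h₀ : W₀.IsIrreducible)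
    (W₁ : Matrix X X ℝ) : Continuous fun θ => perronVec (tilted W₀ W₁ θ)ᵀ :=
  continuous_perronVec (fun θ => (tilted_irreducible h₀ W₁ θ).transpose)
    (continuous_tilted W₀ W₁).matrix_transpose

lemma transpose_mulVec_one {W : Matrix X X ℝ} (hW : W ∈ Matrix.colStochastic ℝ X) :
    Wᵀ *ᵥ (1 : X → ℝ) = (1 : ℝ) • (1 : X → ℝ) := by
  rw [Matrix.mulVec_transpose, Matrix.one_vecMul_of_mem_colStochastic hW, one_smul]

lemma perronVec_transpose_stochastic [Nonempty X] {W : Matrix X X ℝ} (hi : W.IsIrreducible)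
    (hW : W ∈ Matrix.colStochastic ℝ X) : perronVec Wᵀ = 1 :=
  perronVec_eq hi.transpose (fun _ => one_pos) (transpose_mulVec_one hW) (by simp)

lemma perronRoot_stochastic [Nonempty X] {W : Matrix X X ℝ} (hi : W.IsIrreducible)
    (hW : W ∈ Matrix.colStochastic ℝ X) : perronRoot W = 1 := by
  rw [← perronRoot_transpose hi]
  exact perronRoot_eq hi.transpose (fun _ => zero_le_one) one_ne_zero (transpose_mulVec_one hW)

lemma phi_zero [Nonempty X] {W₀ : Matrix X X ℝ} (h₀ : W₀.IsIrreducible)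
    (hW₀ : W₀ ∈ Matrix.colStochastic ℝ X) (W₁ : Matrix X X ℝ) : phi W₀ W₁ 0 = 0 := by
  rw [phi, tilted_zero, perronRoot_stochastic h₀ hW₀, Real.log_one]

lemma expFamily_zero [Nonempty X] {W₀ : Matrix X X ℝ} (h₀ : W₀.IsIrreducible)
    (hW₀ : W₀ ∈ Matrix.colStochastic ℝ X) (W₁ : Matrix X X ℝ) : expFamily W₀ W₁ 0 = W₀ := by
  ext x y
  simp [expFamily, tilted_zero, perronRoot_stochastic h₀ hW₀,
    perronVec_transpose_stochastic h₀ hW₀]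

/-- A diagonal conjugation preserves the eigenvalue, and a factor scales it. -/
lemma perronRoot_conj [Nonempty X] {A : Matrix X X ℝ} (hA : A.IsIrreducible) {c : ℝ} (hc : 0 < c)
    {d : X → ℝ} (hd : ∀ x, 0 < d x) :
    perronRoot (Matrix.of fun x y => c * d x * A x y * (d y)⁻¹) = c * perronRoot A := by
  have hB : (Matrix.of fun x y => c * d x * A x y * (d y)⁻¹).IsIrreducible := by
    refine isIrreducible_congr_support hA (fun x y => ?_) fun x y => ?_
    · exact mul_nonneg (mul_nonneg (mul_pos hc (hd x)).le (hA.nonneg x y)) (inv_pos.2 (hd y)).le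
    · simp [hc.ne', (hd x).ne', (hd y).ne']
  refine perronRoot_eq hB (v := fun x => d x * perronVec A x)
    (fun x => (mul_pos (hd x) (perronVec_pos hA x)).le)
    (fun h => (mul_pos (hd (Classical.arbitrary X)) (perronVec_pos hA _)).ne' (congrFun h _)) ?_
  funext x
  have h := congrFun (mulVec_perronVec hA) x
  simp only [Matrix.mulVec, dotProduct, Pi.smul_apply, smul_eq_mul] at h
  simp only [Matrix.mulVec, dotProduct, Pi.smul_apply, smul_eq_mul, Matrix.of_apply]
  calc ∑ y, c * d x * A x y * (d y)⁻¹ * (d y * perronVec A y)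
      = ∑ y, c * d x * (A x y * perronVec A y) := by
        refine Finset.sum_congr rfl fun y _ => ?_
        have := (hd y).ne'
        field_simp
    _ = c * perronRoot A * (d x * perronVec A x) := by
        rw [← Finset.mul_sum, h]; ring

/-- The geometric mean of `W_a` and `W_b` is a diagonal conjugate of a multiple of the tilted matrix at
the parameter `t a + (1 - t) b`. -/
lemma renyiCumulant_expFamily [Nonempty X] {W₀ : Matrix X X ℝ} (h₀ : W₀.IsIrreducible)
    (W₁ : Matrix X X ℝ) (a b t : ℝ) :
    renyiCumulant (expFamily W₀ W₁ a) (expFamily W₀ W₁ b) t =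
      phi W₀ W₁ (t * a + (1 - t) * b) - t * phi W₀ W₁ a - (1 - t) * phi W₀ W₁ b := by
  have hla := perronRoot_pos (tilted_irreducible h₀ W₁ a)
  have hlb := perronRoot_pos (tilted_irreducible h₀ W₁ b)
  have hva := perronVec_pos (tilted_irreducible h₀ W₁ a).transpose
  have hvb := perronVec_pos (tilted_irreducible h₀ W₁ b).transpose
  set la := perronRoot (tilted W₀ W₁ a)
  set lb := perronRoot (tilted W₀ W₁ b)
  set va := perronVec (tilted W₀ W₁ a)ᵀ
  set vb := perronVec (tilted W₀ W₁ b)ᵀ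
  have hc : 0 < la⁻¹ ^ t * lb⁻¹ ^ (1 - t) := by positivity
  have hd : ∀ x, 0 < va x ^ t * vb x ^ (1 - t) := fun x =>
    mul_pos (Real.rpow_pos_of_pos (hva x) _) (Real.rpow_pos_of_pos (hvb x) _)
  have heq : (Matrix.of fun x y => expFamily W₀ W₁ a x y ^ t * expFamily W₀ W₁ b x y ^ (1 - t)) =
      Matrix.of fun x y => la⁻¹ ^ t * lb⁻¹ ^ (1 - t) * (va x ^ t * vb x ^ (1 - t)) *
        tilted W₀ W₁ (t * a + (1 - t) * b) x y * (va y ^ t * vb y ^ (1 - t))⁻¹ := by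
    ext x y
    simp only [expFamily, Matrix.of_apply, tilted]
    have h1 := hva x
    have h2 := hva y
    have h3 := hvb x
    have h4 := hvb y
    rcases (h₀.nonneg x y).eq_or_lt with h | h
    · -- off the support one of the two exponents is nonzero, so that power of zero vanishes
      rw [← h]
      simp only [zero_mul, mul_zero]
      rcases eq_or_ne t 0 with rfl | ht
      · simp
      · rw [Real.zero_rpow ht, zero_mul]
    · change (la⁻¹ * va x * _ * (va y)⁻¹) ^ t * (lb⁻¹ * vb x * _ * (vb y)⁻¹) ^ (1 - t) = _
      have ha : 0 < la⁻¹ * va x * (W₀ x y * Real.exp (a * Real.log (W₁ x y / W₀ x y))) *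
        (va y)⁻¹ := by positivity
      have hb : 0 < lb⁻¹ * vb x * (W₀ x y * Real.exp (b * Real.log (W₁ x y / W₀ x y))) *
        (vb y)⁻¹ := by positivity
      refine Real.log_injOn_pos (Set.mem_Ioi.2 (by positivity)) (Set.mem_Ioi.2 (by positivity)) ?_
      have e1 : ∀ z : ℝ, Real.log (W₀ x y * Real.exp z) = Real.log (W₀ x y) + z := fun z => by
        rw [Real.log_mul h.ne' (Real.exp_pos _).ne', Real.log_exp]
      have e2 : ∀ z : ℝ, W₀ x y * Real.exp z ≠ 0 := fun z => (mul_pos h (Real.exp_pos _)).ne'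
      rw [Real.log_mul (Real.rpow_pos_of_pos ha _).ne' (Real.rpow_pos_of_pos hb _).ne',
        Real.log_rpow ha, Real.log_rpow hb,
        Real.log_mul (by have := e2 (a * Real.log (W₁ x y / W₀ x y)); positivity) (by positivity),
        Real.log_mul (by positivity) (e2 _), Real.log_mul (by positivity) (by positivity), e1,
        Real.log_mul (by have := e2 (b * Real.log (W₁ x y / W₀ x y)); positivity) (by positivity),
        Real.log_mul (by positivity) (e2 _), Real.log_mul (by positivity) (by positivity), e1,
        Real.log_mul (by have := e2 ((t * a + (1 - t) * b) * Real.log (W₁ x y / W₀ x y)); positivity)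
          (by positivity),
        Real.log_mul (by positivity) (e2 _), e1, Real.log_mul (by positivity) (by positivity),
        Real.log_mul (by positivity) (by positivity), Real.log_mul (by positivity) (by positivity),
        Real.log_inv (_ * _), Real.log_mul (by positivity) (by positivity),
        Real.log_rpow (by positivity), Real.log_rpow (by positivity), Real.log_rpow (by positivity),
        Real.log_rpow (by positivity), Real.log_rpow (by positivity), Real.log_rpow (by positivity),
        Real.log_inv, Real.log_inv, Real.log_inv, Real.log_inv]
      ring
  have hl := perronRoot_pos (tilted_irreducible h₀ W₁ (t * a + (1 - t) * b))
  rw [renyiCumulant, heq, perronRoot_conj (tilted_irreducible h₀ W₁ _) hc hd,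
    Real.log_mul hc.ne' hl.ne', Real.log_mul (by positivity) (by positivity),
    Real.log_rpow (by positivity), Real.log_rpow (by positivity), Real.log_inv, Real.log_inv]
  simp only [phi]
  ring

lemma relRenyi_expFamily [Nonempty X] {W₀ : Matrix X X ℝ} (h₀ : W₀.IsIrreducible)
    (hW₀ : W₀ ∈ Matrix.colStochastic ℝ X) (W₁ : Matrix X X ℝ) (s θ : ℝ) :
    relRenyi s (expFamily W₀ W₁ θ) W₀ =
      (phi W₀ W₁ ((1 + s) * θ) - (1 + s) * phi W₀ W₁ θ) / s := by
  have h := renyiCumulant_expFamily h₀ W₁ θ 0 (1 + s)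
  rw [expFamily_zero h₀ hW₀, phi_zero h₀ hW₀] at h
  rw [relRenyi, h]
  simp

lemma relEntropy_expFamily [Nonempty X] {W₀ : Matrix X X ℝ} (h₀ : W₀.IsIrreducible)
    (W₁ : Matrix X X ℝ) (a b : ℝ) :
    relEntropy (expFamily W₀ W₁ a) (expFamily W₀ W₁ b) =
      (a - b) * deriv (phi W₀ W₁) a - phi W₀ W₁ a + phi W₀ W₁ b := by
  have h1 : HasDerivAt (fun t : ℝ => t * a + (1 - t) * b) (1 * a + (0 - 1) * b) 1 :=
    ((hasDerivAt_id (1 : ℝ)).mul_const a).add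
      (((hasDerivAt_const (1 : ℝ) (1 : ℝ)).sub (hasDerivAt_id (1 : ℝ))).mul_const b)
  have h2 : HasDerivAt (phi W₀ W₁) (deriv (phi W₀ W₁) a) ((1 : ℝ) * a + (1 - 1) * b) := by
    simpa using (differentiable_phi h₀ W₁ a).hasDerivAt
  have h3 : HasDerivAt (fun t : ℝ => t * phi W₀ W₁ a) (1 * phi W₀ W₁ a) 1 :=
    (hasDerivAt_id (1 : ℝ)).mul_const _
  have h4 : HasDerivAt (fun t : ℝ => (1 - t) * phi W₀ W₁ b) ((0 - 1) * phi W₀ W₁ b) 1 :=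
    ((hasDerivAt_const (1 : ℝ) (1 : ℝ)).sub (hasDerivAt_id (1 : ℝ))).mul_const _
  have h5 := ((h2.comp (1 : ℝ) h1).sub h3).sub h4
  rw [relEntropy, show renyiCumulant (expFamily W₀ W₁ a) (expFamily W₀ W₁ b) = _ from
    funext (renyiCumulant_expFamily h₀ W₁ a b)]
  refine h5.deriv.trans ?_
  ring

end Tilting

/-! ### The extended logarithm -/

section ExtendedLog

lemma elog_of_nonpos {x : ℝ} (hx : x ≤ 0) : elog x = ⊥ := by
  rw [elog, ENNReal.log_ofReal, if_pos hx]

lemma elog_of_pos {x : ℝ} (hx : 0 < x) : elog x = (Real.log x : EReal) :=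
  ENNReal.log_ofReal_of_pos hx

lemma elog_mono : Monotone elog := fun _ _ h =>
  ENNReal.log_le_log (ENNReal.ofReal_le_ofReal h)

lemma elog_exp (x : ℝ) : elog (Real.exp x) = (x : EReal) := by
  rw [elog_of_pos (Real.exp_pos x), Real.log_exp]

lemma le_neg_elog {x b : ℝ} (h : b ≤ Real.exp (-x)) : (x : EReal) ≤ -elog b := by
  have := elog_mono h
  rw [elog_exp, EReal.coe_neg] at this
  exact EReal.le_neg_of_le_neg this

lemma neg_elog_le {x b : ℝ} (h : Real.exp (-x) ≤ b) : -elog b ≤ (x : EReal) := by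
  have := elog_mono h
  rw [elog_exp, EReal.coe_neg] at this
  exact EReal.neg_le_of_neg_le this

/-- A term of an upper bound is infinite where its logarithm is. -/
lemma converseTerm_of_nonpos {c d B z : ℝ} (hc : 0 < c) (hd : 0 < d) (hz : z ≤ 0) :
    (c : EReal) * ((B : EReal) - (d : EReal) * elog z) = ⊤ := by
  rw [elog_of_nonpos hz, EReal.coe_mul_bot_of_pos hd, EReal.sub_bot (EReal.coe_ne_bot B),
    EReal.coe_mul_top_of_pos hc]

lemma converseTerm_of_pos {c d B z : ℝ} (hz : 0 < z) :
    (c : EReal) * ((B : EReal) - (d : EReal) * elog z) =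
      ((c * (B - d * Real.log z) : ℝ) : EReal) := by
  rw [elog_of_pos hz]
  norm_cast

end ExtendedLog

/-! ### Hypothesis testing in a finite exponential family -/

section FiniteTesting

variable {Ω : Type*} [Fintype Ω]

/-- Log-convexity of the weighted exponential sum, a form of Hölder's inequality. -/
lemma sum_exp_le_rpow_mul_rpow {w : Ω → ℝ} (hw : ∀ ω, 0 ≤ w ω) (h : Ω → ℝ) (α β : ℝ) {t : ℝ}
    (ht0 : 0 ≤ t) (ht1 : t ≤ 1) :
    ∑ ω, w ω * Real.exp ((t * α + (1 - t) * β) * h ω) ≤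
      (∑ ω, w ω * Real.exp (α * h ω)) ^ t * (∑ ω, w ω * Real.exp (β * h ω)) ^ (1 - t) := by
  rcases ht0.eq_or_lt with rfl | h0
  · simp
  rcases ht1.eq_or_lt with rfl | h1
  · simp
  have h1' : 0 < 1 - t := sub_pos.2 h1
  have hpq : (1 / t).HolderConjugate (1 / (1 - t)) := by
    rw [Real.holderConjugate_iff]
    refine ⟨by rw [lt_div_iff₀ h0]; linarith, ?_⟩
    rw [one_div, one_div, inv_inv, inv_inv]
    ring
  have hnn : ∀ (γ : ℝ) (ω : Ω), 0 ≤ w ω * Real.exp (γ * h ω) := fun γ ω =>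
    mul_nonneg (hw ω) (Real.exp_pos _).le
  have key := Real.inner_le_Lp_mul_Lq_of_nonneg Finset.univ hpq
    (f := fun ω => (w ω * Real.exp (α * h ω)) ^ t)
    (g := fun ω => (w ω * Real.exp (β * h ω)) ^ (1 - t))
    (fun ω _ => Real.rpow_nonneg (hnn α ω) _) (fun ω _ => Real.rpow_nonneg (hnn β ω) _)
  simp only [← Real.rpow_mul (hnn _ _), mul_one_div_cancel h0.ne', mul_one_div_cancel h1'.ne',
    Real.rpow_one, one_div_one_div] at key
  refine le_of_eq_of_le (Finset.sum_congr rfl fun ω _ => ?_) key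
  rw [Real.mul_rpow (hw ω) (Real.exp_pos _).le, Real.mul_rpow (hw ω) (Real.exp_pos _).le,
    ← Real.exp_mul, ← Real.exp_mul, mul_mul_mul_comm, ← Real.exp_add,
    ← Real.rpow_add' (hw ω) (by simp)]
  congr 1
  · simp
  · ring_nf

variable {q h : Ω → ℝ}

/-- Chernoff bound for the likelihood-ratio test `{h < c}` between the laws `q` and `q exp h`. -/
lemma betaDet_le (hq : ∀ ω, 0 ≤ q ω) (hq1 : ∑ ω, q ω = 1) {θ R U : ℝ} (hθ : θ ∈ Set.Ico (0 : ℝ) 1)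
    (hU : ∑ ω, q ω * Real.exp (θ * h ω) ≤ Real.exp U) :
    betaDet (Real.exp (-R)) (fun ω => q ω * Real.exp (h ω)) q ≤
      Real.exp ((θ * R + U) / (1 - θ)) := by
  classical
  have h1 : 0 < 1 - θ := sub_pos.2 hθ.2
  -- this threshold makes the bound on the first-kind error equal to `exp (-R)`
  set c := (-R - U) / (1 - θ) with hc
  have hc' : (1 - θ) * c = -R - U := by rw [hc]; field_simp
  set S : Finset Ω := Finset.univ.filter fun ω => h ω < c with hS
  have hnn : ∀ ω, 0 ≤ q ω * Real.exp (θ * h ω) := fun ω => mul_nonneg (hq ω) (Real.exp_pos _).le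
  have hsub : ∀ S' : Finset Ω, ∑ ω ∈ S', q ω * Real.exp (θ * h ω) ≤ Real.exp U := fun S' =>
    (Finset.sum_le_sum_of_subset_of_nonneg (Finset.subset_univ _) fun ω _ _ => hnn ω).trans hU
  have hbdd : BddBelow {b : ℝ | ∃ S : Finset Ω,
      ∑ ω ∈ S, q ω * Real.exp (h ω) ≤ Real.exp (-R) ∧ b = 1 - ∑ ω ∈ S, q ω} := by
    refine ⟨0, ?_⟩
    rintro b ⟨S', -, rfl⟩
    have := Finset.sum_le_sum_of_subset_of_nonneg (Finset.subset_univ S') fun ω _ _ => hq ω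
    linarith
  refine (csInf_le hbdd ⟨S, ?_, rfl⟩).trans ?_
  · calc ∑ ω ∈ S, q ω * Real.exp (h ω)
        ≤ ∑ ω ∈ S, q ω * Real.exp (θ * h ω) * Real.exp (-R - U) := by
          refine Finset.sum_le_sum fun ω hω => ?_
          rw [mul_assoc, ← Real.exp_add]
          refine mul_le_mul_of_nonneg_left (Real.exp_le_exp.2 ?_) (hq ω)
          have h2 : h ω < c := (Finset.mem_filter.1 hω).2
          have := mul_le_mul_of_nonneg_left h2.le h1.le
          linarith
      _ ≤ Real.exp U * Real.exp (-R - U) := by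
          rw [← Finset.sum_mul]
          exact mul_le_mul_of_nonneg_right (hsub S) (Real.exp_pos _).le
      _ = Real.exp (-R) := by rw [← Real.exp_add]; ring_nf
  · have hcompl : 1 - ∑ ω ∈ S, q ω = ∑ ω ∈ Sᶜ, q ω := by
      rw [← hq1, ← Finset.sum_add_sum_compl S]; ring
    rw [hcompl]
    calc ∑ ω ∈ Sᶜ, q ω
        ≤ ∑ ω ∈ Sᶜ, q ω * Real.exp (θ * h ω) * Real.exp (-(θ * c)) := by
          refine Finset.sum_le_sum fun ω hω => ?_
          rw [mul_assoc, ← Real.exp_add]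
          refine le_mul_of_one_le_right (hq ω) (Real.one_le_exp ?_)
          have h2 : c ≤ h ω := by simpa [hS] using hω
          have := mul_le_mul_of_nonneg_left h2 hθ.1
          linarith
      _ ≤ Real.exp U * Real.exp (-(θ * c)) := by
          rw [← Finset.sum_mul]
          exact mul_le_mul_of_nonneg_right (hsub _) (Real.exp_pos _).le
      _ = Real.exp ((θ * R + U) / (1 - θ)) := by
          rw [← Real.exp_add, hc]
          congr 1
          field_simp
          ring

lemma betaRand_le_betaDet {ε : ℝ} (hε : 0 ≤ ε) {Q₁ Q₀ : Ω → ℝ} (hQ₀ : ∀ ω, 0 ≤ Q₀ ω)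
    (hQ : ∑ ω, Q₀ ω = 1) : betaRand ε Q₁ Q₀ ≤ betaDet ε Q₁ Q₀ := by
  classical
  refine csInf_le_csInf ⟨0, ?_⟩ ⟨1, ∅, by simpa using hε, by simp⟩ ?_
  · rintro b ⟨T, hT, -, rfl⟩
    exact Finset.sum_nonneg fun ω _ => mul_nonneg (hQ₀ ω) (sub_nonneg.2 (hT ω).2)
  · rintro b ⟨S, hS, rfl⟩
    refine ⟨fun ω => if ω ∈ S then 1 else 0, fun ω => ?_, ?_, ?_⟩
    · dsimp only
      split_ifs <;> simp
    · simpa using hS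
    · simp [mul_sub, hQ]

/-- Converse bound for arbitrary tests between `q` and `q exp h`, in terms of bounds on the exponential
sums at `θ`, `(1 + s) θ` and `(1 + θb) θ - θb`. -/
lemma neg_elog_betaRand_le (hq : ∀ ω, 0 ≤ q ω) {R θ s θb L U V : ℝ} (hθb : 0 ≤ θb) (hs : 0 < s)
    (hL : Real.exp L ≤ ∑ ω, q ω * Real.exp (θ * h ω))
    (hU : ∑ ω, q ω * Real.exp ((1 + s) * θ * h ω) ≤ Real.exp U)
    (hV : ∑ ω, q ω * Real.exp (((1 + θb) * θ - θb) * h ω) ≤ Real.exp V) :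
    -elog (betaRand (Real.exp (-R)) (fun ω => q ω * Real.exp (h ω)) q) ≤
      ((1 / s : ℝ) : EReal) * (((U - (1 + s) * L : ℝ) : EReal) - ((1 + s : ℝ) : EReal) *
        elog (1 - 2 * Real.exp ((-(1 + θb) * L + V - θb * R) / (1 + θb)))) := by
  set E := (-(1 + θb) * L + V - θb * R) / (1 + θb) with hE
  rcases le_or_gt (1 - 2 * Real.exp E) 0 with hz | hz
  · rw [converseTerm_of_nonpos (one_div_pos.2 hs) (by linarith) hz]
    exact le_top
  rw [converseTerm_of_pos hz]
  refine neg_elog_le (le_csInf ⟨∑ ω, q ω * (1 - 0), fun _ => 0, by simp, by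
    simpa using (Real.exp_pos _).le, rfl⟩ ?_)
  rintro b ⟨T, hT, hTε, rfl⟩
  have hθb1 : 0 < 1 + θb := by linarith
  have hs1 : 0 < 1 + s := by linarith
  have hw : ∀ ω, 0 ≤ q ω * T ω := fun ω => mul_nonneg (hq ω) (hT ω).1
  have hw' : ∀ ω, 0 ≤ q ω * (1 - T ω) := fun ω => mul_nonneg (hq ω) (sub_nonneg.2 (hT ω).2)
  -- the tilted weight of the rejection region is small, by interpolation with the alternative
  have hacc : ∑ ω, q ω * T ω * Real.exp (θ * h ω) ≤ Real.exp (E + L) := by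
    have hmix := sum_exp_le_rpow_mul_rpow hw h ((1 + θb) * θ - θb) 1 (t := 1 / (1 + θb))
      (by positivity) (by rw [div_le_one hθb1]; linarith)
    have hexp : 1 / (1 + θb) * ((1 + θb) * θ - θb) + (1 - 1 / (1 + θb)) * 1 = θ := by
      field_simp; ring
    have ht1 : 0 ≤ 1 - 1 / (1 + θb) := by
      rw [sub_nonneg, div_le_one hθb1]; linarith
    rw [hexp] at hmix
    refine hmix.trans ?_
    have hA : ∑ ω, q ω * T ω * Real.exp (((1 + θb) * θ - θb) * h ω) ≤ Real.exp V :=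
      (Finset.sum_le_sum fun ω _ => mul_le_mul_of_nonneg_right
        (mul_le_of_le_one_right (hq ω) (hT ω).2) (Real.exp_pos _).le).trans hV
    have hB : ∑ ω, q ω * T ω * Real.exp (1 * h ω) ≤ Real.exp (-R) := by
      refine le_of_eq_of_le (Finset.sum_congr rfl fun ω _ => ?_) hTε
      rw [one_mul]; ring
    have hA0 : 0 ≤ ∑ ω, q ω * T ω * Real.exp (((1 + θb) * θ - θb) * h ω) :=
      Finset.sum_nonneg fun ω _ => mul_nonneg (hw ω) (Real.exp_pos _).le
    have hB0 : 0 ≤ ∑ ω, q ω * T ω * Real.exp (1 * h ω) :=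
      Finset.sum_nonneg fun ω _ => mul_nonneg (hw ω) (Real.exp_pos _).le
    refine (mul_le_mul (Real.rpow_le_rpow hA0 hA (by positivity))
      (Real.rpow_le_rpow hB0 hB ht1) (Real.rpow_nonneg hB0 _)
      (Real.rpow_nonneg (Real.exp_pos _).le _)).trans (le_of_eq ?_)
    rw [← Real.exp_mul, ← Real.exp_mul, ← Real.exp_add, hE]
    congr 1
    field_simp
    ring
  -- hence the acceptance region carries most of the tilted weight
  have hrej : Real.exp L * (1 - 2 * Real.exp E) ≤
      ∑ ω, q ω * (1 - T ω) * Real.exp (θ * h ω) := by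
    have hsplit : ∑ ω, q ω * (1 - T ω) * Real.exp (θ * h ω) =
        ∑ ω, q ω * Real.exp (θ * h ω) - ∑ ω, q ω * T ω * Real.exp (θ * h ω) := by
      rw [← Finset.sum_sub_distrib]
      exact Finset.sum_congr rfl fun ω _ => by ring
    rw [hsplit]
    rw [Real.exp_add] at hacc
    have := mul_pos (Real.exp_pos E) (Real.exp_pos L)
    nlinarith
  have hmix := sum_exp_le_rpow_mul_rpow hw' h ((1 + s) * θ) 0 (t := 1 / (1 + s))
    (by positivity) (by rw [div_le_one hs1]; linarith)
  have hexp : 1 / (1 + s) * ((1 + s) * θ) + (1 - 1 / (1 + s)) * 0 = θ := by field_simp; ring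
  have hexp' : 1 - 1 / (1 + s) = s / (1 + s) := by field_simp; ring
  rw [hexp, hexp'] at hmix
  simp only [zero_mul, Real.exp_zero, mul_one] at hmix
  set β := ∑ ω, q ω * (1 - T ω) with hβ
  have hA : ∑ ω, q ω * (1 - T ω) * Real.exp ((1 + s) * θ * h ω) ≤ Real.exp U :=
    (Finset.sum_le_sum fun ω _ => mul_le_mul_of_nonneg_right
      (mul_le_of_le_one_right (hq ω) (by linarith [(hT ω).1])) (Real.exp_pos _).le).trans hU
  have hβ0 : 0 ≤ β := Finset.sum_nonneg fun ω _ => hw' ω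
  have hchain : Real.exp L * (1 - 2 * Real.exp E) ≤
      Real.exp U ^ (1 / (1 + s)) * β ^ (s / (1 + s)) :=
    hrej.trans (hmix.trans (mul_le_mul_of_nonneg_right
      (Real.rpow_le_rpow (Finset.sum_nonneg fun ω _ => mul_nonneg (hw' ω) (Real.exp_pos _).le) hA
        (by positivity)) (Real.rpow_nonneg hβ0 _)))
  have hlhs : 0 < Real.exp L * (1 - 2 * Real.exp E) := mul_pos (Real.exp_pos _) hz
  have hβpos : 0 < β := by
    refine lt_of_le_of_ne hβ0 fun h0 => ?_
    rw [← h0, Real.zero_rpow (by positivity), mul_zero] at hchain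
    linarith
  have hlog := Real.log_le_log hlhs hchain
  rw [Real.log_mul (Real.exp_pos _).ne' hz.ne', Real.log_exp,
    Real.log_mul (Real.rpow_pos_of_pos (Real.exp_pos _) _).ne'
      (Real.rpow_pos_of_pos hβpos _).ne',
    Real.log_rpow (Real.exp_pos _), Real.log_exp, Real.log_rpow hβpos] at hlog
  rw [← Real.le_log_iff_exp_le hβpos]
  have h3 : (1 + s) * (L + Real.log (1 - 2 * Real.exp E)) ≤ U + s * Real.log β := by
    have := mul_le_mul_of_nonneg_left hlog hs1.le
    calc _ ≤ _ := this
      _ = U + s * Real.log β := by field_simp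
  rw [neg_le, ← sub_nonneg]
  have h4 : 1 / s * (U - (1 + s) * L - (1 + s) * Real.log (1 - 2 * Real.exp E)) - -Real.log β =
      (U + s * Real.log β - (1 + s) * (L + Real.log (1 - 2 * Real.exp E))) / s := by
    field_simp
    ring
  rw [h4]
  exact div_nonneg (sub_nonneg.2 h3) hs.le

end FiniteTesting

/-! ### Path laws -/

section Paths

variable {X : Type*}

/-- The log-likelihood ratio `log (Q₁(ω) / Q₀(ω))` of two Markov path laws, as the sum of the
log-likelihood ratios of the initial state and of the transitions. -/
def pathLogRatio (n : ℕ) (W₀ W₁ : Matrix X X ℝ) (P₀ P₁ : X → ℝ) (ω : Fin (n + 1) → X) : ℝ :=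
  Real.log (P₁ (ω 0) / P₀ (ω 0)) +
    ∑ i : Fin n, Real.log (W₁ (ω i.succ) (ω i.castSucc) / W₀ (ω i.succ) (ω i.castSucc))

lemma pathLaw_tilted (n : ℕ) (W₀ W₁ : Matrix X X ℝ) (P₀ P₁ : X → ℝ) (θ : ℝ)
    (ω : Fin (n + 1) → X) :
    pathLaw n (tilted W₀ W₁ θ) (initVec P₀ P₁ θ) ω =
      pathLaw n W₀ P₀ ω * Real.exp (θ * pathLogRatio n W₀ W₁ P₀ P₁ ω) := by
  simp only [pathLaw, tilted, initVec, pathLogRatio, Matrix.of_apply, Finset.prod_mul_distrib,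
    mul_add, Real.exp_add, Finset.mul_sum, Real.exp_sum]
  ring

lemma initVec_one {P₀ P₁ : X → ℝ} (h₀ : ∀ x, 0 ≤ P₀ x) (h₁ : ∀ x, 0 ≤ P₁ x)
    (hs : ∀ x, P₀ x = 0 ↔ P₁ x = 0) : initVec P₀ P₁ 1 = P₁ := by
  funext x
  simp only [initVec, one_mul]
  exact mul_exp_log_div (h₀ x) (h₁ x) (hs x)

lemma initVec_zero (P₀ P₁ : X → ℝ) : initVec P₀ P₁ 0 = P₀ := by
  funext x
  simp [initVec]

lemma pathLaw_nonneg {n : ℕ} {W : Matrix X X ℝ} {P : X → ℝ} (hW : ∀ x y, 0 ≤ W x y)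
    (hP : ∀ x, 0 ≤ P x) (ω : Fin (n + 1) → X) : 0 ≤ pathLaw n W P ω :=
  mul_nonneg (hP _) (Finset.prod_nonneg fun _ _ => hW _ _)

variable [Fintype X]

/-- A left eigenvector evaluated at the end point of the path integrates to `l ^ n ⟨v, w⟩`. -/
lemma sum_last_mul_pathLaw {A : Matrix X X ℝ} {l : ℝ} {v : X → ℝ} (hv : Aᵀ *ᵥ v = l • v) (n : ℕ)
    (w : X → ℝ) :
    ∑ ω : Fin (n + 1) → X, v (ω (Fin.last n)) * pathLaw n A w ω = l ^ n * ∑ x, v x * w x := by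
  induction n generalizing w with
  | zero =>
    rw [pow_zero, one_mul, ← (Equiv.funUnique (Fin 1) X).sum_comp]
    simp [pathLaw]
  | succ n ih =>
    have hstep : ∑ ω : Fin (n + 1 + 1) → X, v (ω (Fin.last (n + 1))) * pathLaw (n + 1) A w ω =
        ∑ ω : Fin (n + 1) → X, v (ω (Fin.last n)) * pathLaw n A (A *ᵥ w) ω := by
      rw [← (Fin.consEquiv fun _ : Fin (n + 1 + 1) => X).sum_comp, Fintype.sum_prod_type_right]
      refine Finset.sum_congr rfl fun ω _ => ?_
      simp only [pathLaw, Matrix.mulVec, dotProduct, Finset.sum_mul, Finset.mul_sum]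
      refine Finset.sum_congr rfl fun y _ => ?_
      rw [Fin.prod_univ_succ]
      simp only [Fin.consEquiv, Equiv.coe_fn_mk, Fin.cons_succ, Fin.cons_zero, Fin.castSucc_zero,
        ← Fin.succ_last, ← Fin.succ_castSucc]
      ring
    have hinner : ∑ x, v x * (A *ᵥ w) x = l * ∑ x, v x * w x := by
      change v ⬝ᵥ (A *ᵥ w) = l * (v ⬝ᵥ w)
      rw [Matrix.dotProduct_mulVec, ← Matrix.mulVec_transpose, hv, smul_dotProduct, smul_eq_mul]
    rw [hstep, ih, hinner, pow_succ]
    ring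

lemma sum_pathLaw [DecidableEq X] {W : Matrix X X ℝ} {P : X → ℝ} (hW : W ∈ Matrix.colStochastic ℝ X)
    (hP : P ∈ stdSimplex ℝ X) (n : ℕ) : ∑ ω, pathLaw n W P ω = 1 := by
  have h := sum_last_mul_pathLaw (transpose_mulVec_one hW) n P
  simpa [hP.2] using h

lemma sum_mul_initVec_pos {P₀ : X → ℝ} (hP₀ : P₀ ∈ stdSimplex ℝ X) (P₁ : X → ℝ)
    {v : X → ℝ} (hv : ∀ x, 0 < v x) (θ : ℝ) :
    0 < ∑ x, v x * initVec P₀ P₁ θ x := by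
  obtain ⟨x, hx⟩ : ∃ x, P₀ x ≠ 0 := by
    by_contra! hcon
    have := hP₀.2
    simp [hcon] at this
  have hx : 0 < P₀ x := lt_of_le_of_ne (hP₀.1 x) (Ne.symm hx)
  exact Finset.sum_pos' (fun y _ => mul_nonneg (hv y).le
    (mul_nonneg (hP₀.1 y) (Real.exp_pos _).le))
    ⟨x, Finset.mem_univ x, mul_pos (hv x) (mul_pos hx (Real.exp_pos _))⟩

section Bounds

variable [DecidableEq X] [Nonempty X] {W₀ : Matrix X X ℝ} {P₀ : X → ℝ}

lemma exp_deltaUpper_eq (h₀ : W₀.IsIrreducible) (W₁ : Matrix X X ℝ)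
    (hP₀ : P₀ ∈ stdSimplex ℝ X) (P₁ : X → ℝ) (n : ℕ) (θ : ℝ) :
    Real.exp (n * phi W₀ W₁ θ + deltaUpper W₀ W₁ P₀ P₁ θ) =
      ∑ ω : Fin (n + 1) → X, perronVec (tilted W₀ W₁ θ)ᵀ (ω (Fin.last n)) *
        pathLaw n (tilted W₀ W₁ θ) (initVec P₀ P₁ θ) ω := by
  have hi := tilted_irreducible h₀ W₁ θ
  rw [sum_last_mul_pathLaw (mulVec_perronVec hi.transpose), perronRoot_transpose hi, Real.exp_add,
    phi, deltaUpper, Real.exp_log (sum_mul_initVec_pos hP₀ P₁ (perronVec_pos hi.transpose) θ),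
    Real.exp_nat_mul, Real.exp_log (perronRoot_pos hi)]

lemma sum_path_le_exp (h₀ : W₀.IsIrreducible) (W₁ : Matrix X X ℝ)
    (hP₀ : P₀ ∈ stdSimplex ℝ X) (P₁ : X → ℝ) (n : ℕ) (θ : ℝ) :
    ∑ ω, pathLaw n W₀ P₀ ω * Real.exp (θ * pathLogRatio n W₀ W₁ P₀ P₁ ω) ≤
      Real.exp (n * phi W₀ W₁ θ + deltaUpper W₀ W₁ P₀ P₁ θ) := by
  rw [exp_deltaUpper_eq h₀ W₁ hP₀ P₁]
  refine Finset.sum_le_sum fun ω _ => ?_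
  rw [← pathLaw_tilted]
  refine le_mul_of_one_le_left (pathLaw_nonneg (tilted_irreducible h₀ W₁ θ).nonneg
    (fun x => mul_nonneg (hP₀.1 x) (Real.exp_pos _).le) ω) ?_
  exact one_le_perronVec (tilted_irreducible h₀ W₁ θ).transpose _

lemma exp_le_sum_path (h₀ : W₀.IsIrreducible) (W₁ : Matrix X X ℝ)
    (hP₀ : P₀ ∈ stdSimplex ℝ X) (P₁ : X → ℝ) (n : ℕ) (θ : ℝ) :
    Real.exp (n * phi W₀ W₁ θ + deltaLower W₀ W₁ P₀ P₁ θ) ≤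
      ∑ ω, pathLaw n W₀ P₀ ω * Real.exp (θ * pathLogRatio n W₀ W₁ P₀ P₁ ω) := by
  have hi := (tilted_irreducible h₀ W₁ θ).transpose
  have hmax : ∀ x, perronVec (tilted W₀ W₁ θ)ᵀ x ≤ ⨆ x, perronVec (tilted W₀ W₁ θ)ᵀ x := fun x =>
    le_ciSup (Set.finite_range _).bddAbove x
  have hpos : 0 < ⨆ x, perronVec (tilted W₀ W₁ θ)ᵀ x :=
    (perronVec_pos hi (Classical.arbitrary X)).trans_le (hmax _)
  rw [deltaLower, ← add_sub_assoc, Real.exp_sub, Real.exp_log hpos, div_le_iff₀ hpos,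
    exp_deltaUpper_eq h₀ W₁ hP₀ P₁, Finset.sum_mul]
  refine Finset.sum_le_sum fun ω _ => ?_
  rw [← pathLaw_tilted, mul_comm]
  exact mul_le_mul_of_nonneg_left (hmax _) (pathLaw_nonneg (tilted_irreducible h₀ W₁ θ).nonneg
    (fun x => mul_nonneg (hP₀.1 x) (Real.exp_pos _).le) ω)

end Bounds

end Paths

/-! ### Continuity of the boundary terms -/

section Continuity

variable {X : Type*} [Fintype X] [DecidableEq X] [Nonempty X] {W₀ : Matrix X X ℝ} {P₀ : X → ℝ}

lemma continuous_deltaUpper (h₀ : W₀.IsIrreducible) (W₁ : Matrix X X ℝ)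
    (hP₀ : P₀ ∈ stdSimplex ℝ X) (P₁ : X → ℝ) : Continuous (deltaUpper W₀ W₁ P₀ P₁) := by
  have hv := continuous_perronVec_tilted h₀ W₁
  refine Continuous.log ?_ fun θ => (sum_mul_initVec_pos hP₀ P₁
    (perronVec_pos (tilted_irreducible h₀ W₁ θ).transpose) θ).ne'
  refine continuous_finsetSum _ fun x _ => ((continuous_apply x).comp hv).mul ?_
  simp only [initVec]
  fun_prop

lemma continuous_deltaLower (h₀ : W₀.IsIrreducible) (W₁ : Matrix X X ℝ)
    (hP₀ : P₀ ∈ stdSimplex ℝ X) (P₁ : X → ℝ) : Continuous (deltaLower W₀ W₁ P₀ P₁) := by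
  have hv := continuous_perronVec_tilted h₀ W₁
  refine (continuous_deltaUpper h₀ W₁ hP₀ P₁).sub (Continuous.log ?_ fun θ => ?_)
  · simp only [← Finset.sup'_univ_eq_ciSup]
    exact Continuous.finset_sup'_apply _ fun x _ => (continuous_apply x).comp hv
  · exact ((perronVec_pos (tilted_irreducible h₀ W₁ θ).transpose
      (Classical.arbitrary X)).trans_le (le_ciSup (Set.finite_range _).bddAbove _)).ne'

lemma deltaLower_zero (h₀ : W₀.IsIrreducible) (hW₀ : W₀ ∈ Matrix.colStochastic ℝ X)
    (W₁ : Matrix X X ℝ) (hP₀ : P₀ ∈ stdSimplex ℝ X) (P₁ : X → ℝ) :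
    deltaLower W₀ W₁ P₀ P₁ 0 = 0 := by
  simp [deltaLower, deltaUpper, tilted_zero, perronVec_transpose_stochastic h₀ hW₀, initVec_zero,
    hP₀.2]

lemma deltaUpper_zero (h₀ : W₀.IsIrreducible) (hW₀ : W₀ ∈ Matrix.colStochastic ℝ X)
    (W₁ : Matrix X X ℝ) (hP₀ : P₀ ∈ stdSimplex ℝ X) (P₁ : X → ℝ) :
    deltaUpper W₀ W₁ P₀ P₁ 0 = 0 := by
  simp [deltaUpper, tilted_zero, perronVec_transpose_stochastic h₀ hW₀, initVec_zero, hP₀.2]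

end Continuity

/-! ### Comparison of the upper bounds -/

section Comparison

lemma sum_path_zero {X : Type*} [Fintype X] [DecidableEq X] {W₀ : Matrix X X ℝ} {P₀ : X → ℝ}
    (hW₀ : W₀ ∈ Matrix.colStochastic ℝ X) (W₁ : Matrix X X ℝ)
    (hP₀ : P₀ ∈ stdSimplex ℝ X) (P₁ : X → ℝ) (n : ℕ) :
    ∑ ω, pathLaw n W₀ P₀ ω * Real.exp (0 * pathLogRatio n W₀ W₁ P₀ P₁ ω) = 1 := by
  simp [sum_pathLaw hW₀ hP₀]

variable {X : Type*} [Fintype X] [DecidableEq X] [Nonempty X] {W₀ : Matrix X X ℝ} {P₀ : X → ℝ}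

lemma upperBoundB_eq_upperBoundC (h₀ : W₀.IsIrreducible) (hW₀ : W₀ ∈ Matrix.colStochastic ℝ X)
    (W₁ : Matrix X X ℝ) (P₀ P₁ : X → ℝ) (n : ℕ) (θh : ℝ) :
    upperBoundB W₀ W₁ P₀ P₁ n θh = upperBoundC W₀ W₁ P₀ P₁ n θh := by
  unfold upperBoundB upperBoundC
  refine iInf_congr fun s => iInf_congr fun hs => iInf_congr fun θ => iInf_congr fun _ => ?_
  rw [relRenyi_expFamily h₀ hW₀, relEntropy_expFamily h₀]
  have hE : -(n * ((θh - θ) * deriv (phi W₀ W₁) θh - phi W₀ W₁ θh + phi W₀ W₁ θ)) =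
      n * (-phi W₀ W₁ θ + phi W₀ W₁ θh + (θ - θh) * deriv (phi W₀ W₁) θh) := by ring
  rw [hE]
  have hs1 : 0 < 1 + s := by linarith
  generalize 1 - 2 * Real.exp _ = z
  rcases le_or_gt z 0 with hz | hz
  · rw [converseTerm_of_nonpos (one_div_pos.2 hs) hs1 hz, elog_of_nonpos hz,
      EReal.coe_mul_bot_of_pos (div_pos hs1 hs), EReal.sub_bot (EReal.coe_ne_bot _)]
  · rw [converseTerm_of_pos hz, elog_of_pos hz, ← EReal.coe_mul, ← EReal.coe_sub]
    congr 1
    field_simp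

/-- Convexity of `θ ↦ log M(θ)` between `0`, where it vanishes, and `θ`, with `log M` replaced by its
lower bound on the left and by its upper bound on the right. -/
lemma lower_le_mul_upper (h₀ : W₀.IsIrreducible) (hW₀ : W₀ ∈ Matrix.colStochastic ℝ X)
    (W₁ : Matrix X X ℝ) (hP₀ : P₀ ∈ stdSimplex ℝ X) (P₁ : X → ℝ) (n : ℕ) {t : ℝ} (ht0 : 0 ≤ t)
    (ht1 : t ≤ 1) (θ : ℝ) :
    n * phi W₀ W₁ (t * θ) + deltaLower W₀ W₁ P₀ P₁ (t * θ) ≤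
      t * (n * phi W₀ W₁ θ + deltaUpper W₀ W₁ P₀ P₁ θ) := by
  have hq : ∀ ω, 0 ≤ pathLaw n W₀ P₀ ω := pathLaw_nonneg h₀.nonneg hP₀.1
  have hmix := sum_exp_le_rpow_mul_rpow hq (pathLogRatio n W₀ W₁ P₀ P₁) θ 0 ht0 ht1
  rw [mul_zero, add_zero, sum_path_zero hW₀ W₁ hP₀, Real.one_rpow, mul_one] at hmix
  rw [← Real.exp_le_exp]
  refine (exp_le_sum_path h₀ W₁ hP₀ P₁ n _).trans (hmix.trans ?_)
  rw [mul_comm t, Real.exp_mul]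
  exact Real.rpow_le_rpow (Finset.sum_nonneg fun ω _ => mul_nonneg (hq ω) (Real.exp_pos _).le)
    (sum_path_le_exp h₀ W₁ hP₀ P₁ n θ) ht0

/-- The value on the right is the limit of the terms of `upperBoundA` for fixed `s`, `θb` as `θ → 0⁺`. -/
lemma upperBoundA_le_limit (h₀ : W₀.IsIrreducible) (hW₀ : W₀ ∈ Matrix.colStochastic ℝ X)
    (W₁ : Matrix X X ℝ) (hP₀ : P₀ ∈ stdSimplex ℝ X) (P₁ : X → ℝ) (n : ℕ) {r s θb : ℝ}
    (hθb : 0 ≤ θb) (hs : 0 < s)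
    (hz : 0 < 1 - 2 * Real.exp ((n * phi W₀ W₁ (-θb) + deltaUpper W₀ W₁ P₀ P₁ (-θb) -
      θb * (n * r)) / (1 + θb))) :
    upperBoundA W₀ W₁ P₀ P₁ n r ≤ ((1 / s * (0 - (1 + s) * Real.log (1 - 2 * Real.exp
      ((n * phi W₀ W₁ (-θb) + deltaUpper W₀ W₁ P₀ P₁ (-θb) - θb * (n * r)) / (1 + θb)))) : ℝ) :
        EReal) := by
  have hφ : Continuous (phi W₀ W₁) := (differentiable_phi h₀ W₁).continuous
  have hδ := continuous_deltaUpper h₀ W₁ hP₀ P₁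
  have hδ' := continuous_deltaLower h₀ W₁ hP₀ P₁
  let E : ℝ → ℝ := fun θ =>
    n * ((-(1 + θb) * phi W₀ W₁ θ + phi W₀ W₁ ((1 + θb) * θ - θb) - θb * r) / (1 + θb))
            + (-(1 + θb) * deltaLower W₀ W₁ P₀ P₁ θ
                + deltaUpper W₀ W₁ P₀ P₁ ((1 + θb) * θ - θb)) / (1 + θb)
  let D : ℝ → ℝ := fun θ => n * (phi W₀ W₁ ((1 + s) * θ) - (1 + s) * phi W₀ W₁ θ)
          + (deltaUpper W₀ W₁ P₀ P₁ ((1 + s) * θ) - (1 + s) * deltaLower W₀ W₁ P₀ P₁ θ)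
  have hE : Continuous E := by fun_prop
  have hD : Continuous D := by fun_prop
  have hE0 : E 0 = (n * phi W₀ W₁ (-θb) + deltaUpper W₀ W₁ P₀ P₁ (-θb) - θb * (n * r)) /
      (1 + θb) := by
    simp only [E, mul_zero, zero_sub, phi_zero h₀ hW₀, deltaLower_zero h₀ hW₀ W₁ hP₀]
    ring
  have hD0 : D 0 = 0 := by
    simp [D, phi_zero h₀ hW₀, deltaLower_zero h₀ hW₀ W₁ hP₀, deltaUpper_zero h₀ hW₀ W₁ hP₀]
  rw [← hE0] at hz ⊢
  let G : ℝ → ℝ := fun θ => 1 / s * (D θ - (1 + s) * Real.log (1 - 2 * Real.exp (E θ)))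
  have hG0 : G 0 = 1 / s * (0 - (1 + s) * Real.log (1 - 2 * Real.exp (E 0))) := by
    simp only [G, hD0]
  rw [← hG0]
  have hz' : Continuous fun θ => 1 - 2 * Real.exp (E θ) := by fun_prop
  have hG : ContinuousAt G 0 := by
    have : ContinuousAt (fun θ => Real.log (1 - 2 * Real.exp (E θ))) 0 :=
      hz'.continuousAt.log hz.ne'
    exact continuousAt_const.mul (hD.continuousAt.sub (continuousAt_const.mul this))
  have hlim : Filter.Tendsto (fun θ => (G θ : EReal)) (nhdsWithin 0 (Set.Ioi 0)) (nhds (G 0)) :=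
    ((continuous_coe_real_ereal.tendsto (G 0)).comp hG).mono_left nhdsWithin_le_nhds
  refine ge_of_tendsto hlim ?_
  have hev : ∀ᶠ θ in nhdsWithin (0 : ℝ) (Set.Ioi 0), 0 < 1 - 2 * Real.exp (E θ) :=
    (hz'.continuousAt.eventually (lt_mem_nhds hz)).filter_mono nhdsWithin_le_nhds
  filter_upwards [hev, Ioo_mem_nhdsGT (zero_lt_one' ℝ)] with θ hθ hθ'
  refine (iInf_le_of_le θb <| iInf_le_of_le hθb <| iInf_le_of_le s <| iInf_le_of_le hs <|
    iInf_le_of_le θ <| iInf_le_of_le hθ' le_rfl).trans (le_of_eq ?_)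
  exact converseTerm_of_pos hθ

/-- Only the equation for `θh` enters, not its minimality. -/
lemma upperBoundA_le_upperBoundB (h₀ : W₀.IsIrreducible) (hW₀ : W₀ ∈ Matrix.colStochastic ℝ X)
    (W₁ : Matrix X X ℝ) (hP₀ : P₀ ∈ stdSimplex ℝ X) (P₁ : X → ℝ) (n : ℕ) {r θh : ℝ}
    (hr : (θh - 1) * deriv (phi W₀ W₁) θh - phi W₀ W₁ θh = r) :
    upperBoundA W₀ W₁ P₀ P₁ n r ≤ upperBoundB W₀ W₁ P₀ P₁ n θh := by
  refine le_iInf fun s => le_iInf fun hs => le_iInf fun θ => le_iInf fun hθ => ?_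
  have h1 : 0 < 1 - θ := sub_pos.2 hθ.2
  have h2 : 0 < 1 - θh := by linarith [hθ.1]
  have hs1 : 0 < 1 + s := by linarith
  rcases lt_or_ge 0 θ with hpos | hneg
  · -- the parameter `θb` for which the tilt `(1 + θb) θ - θb` is `θh`
    have hθb : 0 ≤ (θ - θh) / (1 - θ) := div_nonneg (by linarith [hθ.1]) h1.le
    refine (iInf_le_of_le ((θ - θh) / (1 - θ)) <| iInf_le_of_le hθb <| iInf_le_of_le s <|
      iInf_le_of_le hs <| iInf_le_of_le θ <| iInf_le_of_le ⟨hpos, hθ.2⟩ le_rfl).trans (le_of_eq ?_)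
    have e1 : 1 + (θ - θh) / (1 - θ) = (1 - θh) / (1 - θ) := by field_simp; ring
    have e2 : (1 - θh) / (1 - θ) * θ - (θ - θh) / (1 - θ) = θh := by field_simp; ring
    rw [e1, e2, ← hr]
    congr 5
    field_simp
    ring_nf
  · have hθh : θh < 0 := hθ.1.trans_le hneg
    set U := n * phi W₀ W₁ θh + deltaUpper W₀ W₁ P₀ P₁ θh with hU
    set E₀ := (U - -θh * (n * r)) / (1 + -θh) with hE₀
    set E := n * (-phi W₀ W₁ θ + phi W₀ W₁ θh + (θ - θh) * deriv (phi W₀ W₁) θh)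
            - deltaLower W₀ W₁ P₀ P₁ θ
            + (1 - θ) * deltaUpper W₀ W₁ P₀ P₁ θh / (1 - θh) with hE
    rcases le_or_gt (1 - 2 * Real.exp E) 0 with hz | hz
    · rw [converseTerm_of_nonpos (one_div_pos.2 hs) hs1 hz]
      exact le_top
    have ht0 : 0 ≤ θ / θh := div_nonneg_of_nonpos hneg hθh.le
    have ht1 : θ / θh < 1 := by rw [div_lt_one_of_neg hθh]; exact hθ.1
    -- convexity between `θh` and `0`
    have hconv := lower_le_mul_upper h₀ hW₀ W₁ hP₀ P₁ n ht0 ht1.le θh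
    rw [div_mul_cancel₀ _ hθh.ne, ← hU] at hconv
    have hlin : E = -(n * phi W₀ W₁ θ + deltaLower W₀ W₁ P₀ P₁ θ) + θ / θh * U +
        (1 - θ / θh) * E₀ := by
      have h3 : (1 : ℝ) + -θh ≠ 0 := by linarith
      have h4 := hθh.ne
      rw [hE, hE₀, hU, ← hr, ← sub_eq_add_neg]
      field_simp
      ring
    have hEge : (1 - θ / θh) * E₀ ≤ E := by linarith
    have hE0 : E < 0 := by
      rw [← Real.exp_lt_one_iff]
      linarith [Real.exp_pos E]
    have hE₀neg : E₀ ≤ 0 := by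
      by_contra! hcon
      have := mul_pos (sub_pos.2 ht1) hcon
      linarith
    have hE₀E : E₀ ≤ E := by
      have := mul_nonpos_of_nonpos_of_nonneg hE₀neg ht0
      linarith
    have hzz : 1 - 2 * Real.exp E ≤ 1 - 2 * Real.exp E₀ := by
      linarith [Real.exp_le_exp.2 hE₀E]
    have hlimit := upperBoundA_le_limit h₀ hW₀ W₁ hP₀ P₁ n (r := r) (s := s) (θb := -θh)
      (by linarith) hs (by rw [neg_neg]; exact hz.trans_le hzz)
    rw [neg_neg] at hlimit
    refine hlimit.trans ?_
    rw [converseTerm_of_pos hz, EReal.coe_le_coe_iff]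
    refine mul_le_mul_of_nonneg_left ?_ (one_div_pos.2 hs).le
    have hlog := mul_le_mul_of_nonneg_left (Real.log_le_log hz hzz) hs1.le
    have hdiv := lower_le_mul_upper h₀ hW₀ W₁ hP₀ P₁ n (t := 1 / (1 + s)) (by positivity)
      (by rw [div_le_one hs1]; linarith) ((1 + s) * θ)
    rw [← mul_assoc, one_div_mul_cancel hs1.ne', one_mul, one_div_mul_eq_div,
      le_div_iff₀ hs1] at hdiv
    linarith

end Comparison

end MarkovTest

end

theorem theorem9 {X : Type*} [Fintype X] [DecidableEq X]
    (W₀ W₁ : Matrix X X ℝ)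
    (hW₀ : W₀ ∈ Matrix.colStochastic ℝ X) (hW₁ : W₁ ∈ Matrix.colStochastic ℝ X)
    (hirr₀ : W₀.IsIrreducible) (hirr₁ : W₁.IsIrreducible)
    (hWsupp : ∀ x y, W₀ x y = 0 ↔ W₁ x y = 0)
    (P₀ P₁ : X → ℝ) (hP₀ : P₀ ∈ stdSimplex ℝ X) (hP₁ : P₁ ∈ stdSimplex ℝ X)
    (hPsupp : ∀ x, P₀ x = 0 ↔ P₁ x = 0)
    (n : ℕ) (r : ℝ) (hr : 0 < r) :
    MarkovTest.lowerBound W₀ W₁ P₀ P₁ n r ≤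
        -MarkovTest.elog (MarkovTest.betaDet (Real.exp (-(n * r)))
          (MarkovTest.pathLaw n W₁ P₁) (MarkovTest.pathLaw n W₀ P₀)) ∧
      -MarkovTest.elog (MarkovTest.betaDet (Real.exp (-(n * r)))
          (MarkovTest.pathLaw n W₁ P₁) (MarkovTest.pathLaw n W₀ P₀)) ≤
        -MarkovTest.elog (MarkovTest.betaRand (Real.exp (-(n * r)))
          (MarkovTest.pathLaw n W₁ P₁) (MarkovTest.pathLaw n W₀ P₀)) ∧
      -MarkovTest.elog (MarkovTest.betaRand (Real.exp (-(n * r)))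
          (MarkovTest.pathLaw n W₁ P₁) (MarkovTest.pathLaw n W₀ P₀)) ≤
        MarkovTest.upperBoundA W₀ W₁ P₀ P₁ n r ∧
      ∀ θh : ℝ, MarkovTest.IsThetaHat W₀ W₁ r θh →
        MarkovTest.upperBoundA W₀ W₁ P₀ P₁ n r ≤ MarkovTest.upperBoundB W₀ W₁ P₀ P₁ n θh ∧
        MarkovTest.upperBoundB W₀ W₁ P₀ P₁ n θh = MarkovTest.upperBoundC W₀ W₁ P₀ P₁ n θh := by
  open MarkovTest in
  have : Nonempty X := by
    by_contra hX
    rw [not_nonempty_iff] at hX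
    simpa using hP₀.2
  have hq : ∀ ω, 0 ≤ pathLaw n W₀ P₀ ω := pathLaw_nonneg hirr₀.nonneg hP₀.1
  have hq1 : ∑ ω, pathLaw n W₀ P₀ ω = 1 := sum_pathLaw hW₀ hP₀ n
  have hQ₁ : pathLaw n W₁ P₁ = fun ω =>
      pathLaw n W₀ P₀ ω * Real.exp (pathLogRatio n W₀ W₁ P₀ P₁ ω) := by
    funext ω
    have h := pathLaw_tilted n W₀ W₁ P₀ P₁ 1 ω
    rwa [tilted_one hirr₀ hirr₁ hWsupp, initVec_one hP₀.1 hP₁.1 hPsupp, one_mul] at h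
  refine ⟨?_, ?_, ?_, fun θh hθh => ⟨?_, ?_⟩⟩
  · refine iSup_le fun θ => iSup_le fun hθ => le_neg_elog ?_
    rw [hQ₁]
    refine (betaDet_le hq hq1 hθ (sum_path_le_exp hirr₀ W₁ hP₀ P₁ n θ)).trans
      (le_of_eq (congrArg Real.exp ?_))
    ring
  · exact EReal.neg_le_neg_iff.2
      (elog_mono (betaRand_le_betaDet (Real.exp_pos _).le hq hq1))
  · refine le_iInf fun θb => le_iInf fun hθb => le_iInf fun s => le_iInf fun hs =>
      le_iInf fun θ => le_iInf fun _ => ?_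
    rw [hQ₁]
    refine (neg_elog_betaRand_le hq hθb hs (exp_le_sum_path hirr₀ W₁ hP₀ P₁ n θ)
      (sum_path_le_exp hirr₀ W₁ hP₀ P₁ n _) (sum_path_le_exp hirr₀ W₁ hP₀ P₁ n _)).trans
      (le_of_eq ?_)
    congr 5
    · ring_nf
    · ring_nf
  · exact upperBoundA_le_upperBoundB hirr₀ hW₀ W₁ hP₀ P₁ n hθh.1
  · exact upperBoundB_eq_upperBoundC hirr₀ hW₀ W₁ P₀ P₁ n θh
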